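/- Let $V=\mathbb Z_{\ge 0}$ or $V=\mathbb Z$. Consider the homogeneous continuous-time open quantum walk on $V$ with internal space $\mathbb C^2$ (orthonormal basis $e_0,e_1$), without Hamiltonian part, in which the transition operator from $i$ to $i+1$ is $A=\mathrm{diag}(a_1,a_2)$ and the transition operator from $i+1$ to $i$ is $C=\mathrm{diag}(c_1,c_2)$ for all $i,i+1\in V$, with no other transitions, where $a_1,a_2,c_1,c_2>0$. That is, on families $\rho=(\rho(i))_{i\in V}$ of $2\times 2$ complex matrices with $\sum_i\mathrm{Tr}|\rho(i)|<\infty$ the walk is the semigroup $e^{t\mathcal L}$ with the bounded generator $$(\mathcal L\rho)(i)=G_i\rho(i)+\rho(i)G_i^*+A\rho(i-1)A^*+C\rho(i+1)C^*,$$ where $G_i=-\tfrac12(A^*A+C^*C)$, except that on $\mathbb Z_{\ge0}$ one has $G_0=-\tfrac12A^*A$ and the term $A\rho(-1)A^*$ is absent. For a density matrix $\rho=\begin{pmatrix}a&b\\ \bar b&1-a\end{pmatrix}$ (positive semidefinite, trace one) let $p_{ii;\rho}(t)=\mathrm{Tr}\big[(e^{t\mathcal L}(\rho\otimes|i\rangle\langle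 i|))(i)\big]$. Vertex $i$ is called $\rho$-recurrent if $\int_0^\infty p_{ii;\rho}(t)\,dt=\infty$ and $\rho$-transient if this integral is finite; it is called recurrent (transient) if it is $\rho$-recurrent ($\rho$-transient) for every density matrix $\rho$. (1) On $\mathbb Z_{\ge0}$: vertex $0$ is recurrent if and only if $a_k\le c_k$ for both $k=1,2$, and transient if and only if $a_k>c_k$ for both $k=1,2$. If $a_1\le c_1$ and $a_2>c_2$, then vertex $0$ is $|e_1\rangle\langle e_1|$-transient, and $\rho$-recurrent for every density matrix $\rho\ne|e_1\rangle\langle e_1|$. If $a_1>c_1$ and $a_2\le c_2$, then vertex $0$ is $|e_0\rangle\langle e_0|$-transient, and $\rho$-recurrent for every density matrix $\rho\neq|e_0\rangle\langle e_0|$. (2) On $\mathbb Z$, for every vertex $i$: vertex $i$ is recurrent if and only if $a_k=c_k$ for both $k=1,2$, and transient if and only if $a_k\ne c_k$ for both $k=1,2$. If $a_1=c_1$ and $a_2\ne c_2$, then vertex $i$ is $\rho$-transient when $a=0$ and $\rho$-recurrent when $a>0$. If $a_1\neq c_1$ and $a_2=c_2$, then vertex $i$ is $\rho$-transient when $a=1$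 and $\rho$-recurrent when $a<1$. -/

import Mathlib

open scoped ENNReal Matrix

namespace OpenQuantumWalk

section

/- The Frobenius norm is the norm on the finite-dimensional blocks. All norms on a block are
equivalent, so the space `BlockState` below is, as a topological vector space, the space of
block diagonal trace-class operators `∑ i, ρ i ⊗ |i⟩⟨i|`, i.e. of families with
`∑ i, Tr |ρ i| < ∞`. -/
open scoped Matrix.Norms.Frobenius

/-- Block diagonal trace-class operators on `⨁ i : V, ℂⁿ`: absolutely summable families
`(ρ i)` of `n × n` complex matrices. -/
abbrev BlockState (V n : Type) [Fintype n] [DecidableEq n] : Type :=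
  lp (fun _ : V => Matrix n n ℂ) 1

/-- The data of a continuous-time open quantum walk with vertex set `V` and internal space `ℂⁿ`
at every vertex: Hamiltonians `H i`, and transition operators `R i j` for the jump from vertex `i`
to vertex `j`. The last two fields say that `∑ i, H i ⊗ |i⟩⟨i|` and the sum
`∑ i j, (S i j)ᴴ (S i j)`, with `S i j = R i j ⊗ |j⟩⟨i|`, are bounded operators. -/
structure CTOQW (V n : Type) [Fintype n] [DecidableEq n] where
  H : V → Matrix n n ℂ
  R : V → V → Matrix n n ℂ
  isHermitian_H : ∀ i, (H i).IsHermitian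
  bounded_H : ∃ M : ℝ, ∀ i, ‖H i‖ ≤ M
  bounded_R : ∃ M : ℝ, ∀ (i : V) (s : Finset V), ∑ j ∈ s, ‖R i j‖ ^ 2 ≤ M

namespace CTOQW

variable {V n : Type} [Fintype n] [DecidableEq n]

/-- The effective Hamiltonian part `G i = -i H i - (1/2) ∑ j, (R i j)ᴴ (R i j)`. -/
noncomputable def G (W : CTOQW V n) (i : V) : Matrix n n ℂ :=
  -(Complex.I • W.H i) - (1 / 2 : ℂ) • ∑' j, (W.R i j)ᴴ * W.R i j

/-- The `i`-th block of the Lindblad generator applied to `∑ i, ρ i ⊗ |i⟩⟨i|`: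
`G i ρ(i) + ρ(i) (G i)ᴴ + ∑ j, R j i ρ(j) (R j i)ᴴ`. -/
noncomputable def generatorBlock (W : CTOQW V n) (ρ : V → Matrix n n ℂ) (i : V) :
    Matrix n n ℂ :=
  W.G i * ρ i + ρ i * (W.G i)ᴴ + ∑' j, W.R j i * ρ j * (W.R j i)ᴴ

theorem norm_conj_le (A ρ : Matrix n n ℂ) : ‖A * ρ * Aᴴ‖ ≤ ‖A‖ ^ 2 * ‖ρ‖ := by
  calc ‖A * ρ * Aᴴ‖ ≤ ‖A‖ * ‖ρ‖ * ‖A‖ := by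
        refine (norm_mul_le _ _).trans ?_
        rw [Matrix.frobenius_norm_conjTranspose]
        gcongr
        exact norm_mul_le _ _
    _ = ‖A‖ ^ 2 * ‖ρ‖ := by ring

theorem summable_R (W : CTOQW V n) (i : V) : Summable fun j => ‖W.R i j‖ ^ 2 := by
  obtain ⟨M, hM⟩ := W.bounded_R
  exact summable_of_sum_le (fun j => by positivity) (hM i)

theorem exists_bound (W : CTOQW V n) :
    ∃ M : ℝ, 0 ≤ M ∧ (∀ i, ‖W.G i‖ ≤ M) ∧ ∀ i, ∑' j, ‖W.R i j‖ ^ 2 ≤ M := by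
  obtain ⟨M, hM⟩ := W.bounded_R
  obtain ⟨N, hN⟩ := W.bounded_H
  have hS : ∀ i, ∑' j, ‖W.R i j‖ ^ 2 ≤ M := fun i => (W.summable_R i).tsum_le_of_sum_le (hM i)
  have hb : ∀ i, ‖W.G i‖ ≤ |N| + |M| := by
    intro i
    have h1 : ‖∑' j, (W.R i j)ᴴ * W.R i j‖ ≤ ∑' j, ‖W.R i j‖ ^ 2 := by
      refine tsum_of_norm_bounded (W.summable_R i).hasSum fun j => ?_
      refine (norm_mul_le _ _).trans ?_
      rw [Matrix.frobenius_norm_conjTranspose, sq]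
    have h2 : ‖-(Complex.I • W.H i)‖ ≤ |N| := by
      rw [norm_neg, norm_smul, Complex.norm_I, one_mul]
      exact (hN i).trans (le_abs_self N)
    have h3 : ‖(1 / 2 : ℂ) • ∑' j, (W.R i j)ᴴ * W.R i j‖ ≤ |M| := by
      rw [norm_smul]
      have h4 : ‖(1 / 2 : ℂ)‖ = 1 / 2 := by norm_num
      rw [h4]
      have h5 := (h1.trans (hS i)).trans (le_abs_self M)
      have h6 := norm_nonneg (∑' j, (W.R i j)ᴴ * W.R i j)
      linarith
    exact (norm_sub_le _ _).trans (add_le_add h2 h3)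
  exact ⟨|N| + |M|, by positivity, hb,
    fun i => (hS i).trans ((le_abs_self M).trans (le_add_of_nonneg_left (abs_nonneg N)))⟩

theorem summable_norm (ρ : BlockState V n) : Summable fun i => ‖ρ i‖ := by
  have h := (lp.memℓp ρ).summable (by norm_num)
  simpa using h

theorem norm_eq_tsum (ρ : BlockState V n) : ‖ρ‖ = ∑' i, ‖ρ i‖ := by
  have h := lp.norm_eq_tsum_rpow (p := 1) (by norm_num) ρ
  simpa using h

theorem summable_tsum_weight {V : Type} (f : V → V → ℝ) (u : V → ℝ) (M : ℝ)
    (hf : ∀ j i, 0 ≤ f j i) (hM : ∀ j, ∑' i, f j i ≤ M)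
    (hu : ∀ j, 0 ≤ u j) (hus : Summable u) : Summable fun j => ∑' i, f j i * u j := by
  have h1 : ∀ j, ∑' i, f j i * u j = (∑' i, f j i) * u j := fun _ => tsum_mul_right
  simp only [h1]
  exact Summable.of_nonneg_of_le (fun j => mul_nonneg (tsum_nonneg (hf j)) (hu j))
    (fun j => mul_le_mul_of_nonneg_right (hM j) (hu j)) (hus.mul_left M)

theorem summable_prod_weight {V : Type} (f : V → V → ℝ) (u : V → ℝ)
    (hfs : ∀ j, Summable (f j)) (h0 : (0 : V × V → ℝ) ≤ fun q => f q.1 q.2 * u q.1)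
    (h2 : Summable fun j => ∑' i, f j i * u j) :
    Summable fun q : V × V => f q.1 q.2 * u q.1 :=
  (summable_prod_of_nonneg h0).2 ⟨fun j => (hfs j).mul_right (u j), h2⟩

theorem summable_jump (W : CTOQW V n) (ρ : BlockState V n) :
    Summable fun q : V × V => ‖W.R q.1 q.2‖ ^ 2 * ‖ρ q.1‖ := by
  obtain ⟨M, -, -, hM⟩ := W.exists_bound
  refine summable_prod_weight (fun j i => ‖W.R j i‖ ^ 2) (fun j => ‖ρ j‖) W.summable_R ?_ ?_
  · intro q
    exact mul_nonneg (sq_nonneg ‖W.R q.1 q.2‖) (norm_nonneg (ρ q.1))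
  · exact summable_tsum_weight (fun j i => ‖W.R j i‖ ^ 2) (fun j => ‖ρ j‖) M
      (fun j i => sq_nonneg _) hM (fun j => norm_nonneg _) (summable_norm ρ)

theorem summable_jump_block (W : CTOQW V n) (ρ : BlockState V n) (i : V) :
    Summable fun j => W.R j i * ρ j * (W.R j i)ᴴ := by
  refine Summable.of_norm_bounded ?_ (fun j => norm_conj_le _ _)
  exact (W.summable_jump ρ).prod_symm.prod_factor i

theorem summable_jump_norm (W : CTOQW V n) (ρ : BlockState V n) :
    Summable fun i => ∑' j, ‖W.R j i‖ ^ 2 * ‖ρ j‖ :=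
  (W.summable_jump ρ).prod_symm.prod

theorem norm_generatorBlock_le (W : CTOQW V n) {M : ℝ} (hG : ∀ i, ‖W.G i‖ ≤ M)
    (ρ : BlockState V n) (i : V) :
    ‖W.generatorBlock ρ i‖ ≤ 2 * M * ‖ρ i‖ + ∑' j, ‖W.R j i‖ ^ 2 * ‖ρ j‖ := by
  have h1 : ‖W.G i * ρ i‖ ≤ M * ‖ρ i‖ :=
    (norm_mul_le _ _).trans (mul_le_mul_of_nonneg_right (hG i) (norm_nonneg _))
  have h2 : ‖ρ i * (W.G i)ᴴ‖ ≤ M * ‖ρ i‖ := by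
    refine (norm_mul_le _ _).trans ?_
    rw [Matrix.frobenius_norm_conjTranspose, mul_comm]
    exact mul_le_mul_of_nonneg_right (hG i) (norm_nonneg _)
  have h3 : ‖∑' j, W.R j i * ρ j * (W.R j i)ᴴ‖ ≤ ∑' j, ‖W.R j i‖ ^ 2 * ‖ρ j‖ :=
    tsum_of_norm_bounded ((W.summable_jump ρ).prod_symm.prod_factor i).hasSum
      fun j => norm_conj_le _ _
  refine (norm_add_le _ _).trans ?_
  have h4 := norm_add_le (W.G i * ρ i) (ρ i * (W.G i)ᴴ)
  linarith

theorem summable_bound (W : CTOQW V n) (M : ℝ) (ρ : BlockState V n) :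
    Summable fun i => 2 * M * ‖ρ i‖ + ∑' j, ‖W.R j i‖ ^ 2 * ‖ρ j‖ :=
  ((summable_norm ρ).mul_left _).add (W.summable_jump_norm ρ)

theorem summable_generatorBlock (W : CTOQW V n) (ρ : BlockState V n) :
    Summable fun i => ‖W.generatorBlock ρ i‖ := by
  obtain ⟨M, -, hG, -⟩ := W.exists_bound
  exact Summable.of_nonneg_of_le (fun i => norm_nonneg _)
    (W.norm_generatorBlock_le hG ρ) (W.summable_bound M ρ)

theorem memℓp_generatorBlock (W : CTOQW V n) (ρ : BlockState V n) :
    Memℓp (W.generatorBlock ρ) 1 :=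
  memℓp_gen (by simpa using W.summable_generatorBlock ρ)

/-- The generator as a linear map. -/
noncomputable def generatorLinear (W : CTOQW V n) : BlockState V n →ₗ[ℂ] BlockState V n where
  toFun ρ := ⟨W.generatorBlock ρ, W.memℓp_generatorBlock ρ⟩
  map_add' ρ σ := by
    ext1
    funext i
    have h := (W.summable_jump_block ρ i).tsum_add (W.summable_jump_block σ i)
    simp only [generatorBlock, lp.coeFn_add, Pi.add_apply, mul_add, add_mul, h]
    abel
  map_smul' z ρ := by
    ext1
    funext i
    have h := (W.summable_jump_block ρ i).tsum_const_smul z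
    simp only [generatorBlock, lp.coeFn_smul, Pi.smul_apply, Matrix.mul_smul, Matrix.smul_mul,
      RingHom.id_apply, h, smul_add]

theorem exists_norm_generatorLinear_le (W : CTOQW V n) :
    ∃ K : ℝ, ∀ ρ, ‖W.generatorLinear ρ‖ ≤ K * ‖ρ‖ := by
  obtain ⟨M, hM0, hG, hM⟩ := W.exists_bound
  refine ⟨3 * M, fun ρ => ?_⟩
  have h1 : ‖W.generatorLinear ρ‖ ≤
      ∑' i, (2 * M * ‖ρ i‖ + ∑' j, ‖W.R j i‖ ^ 2 * ‖ρ j‖) := by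
    rw [norm_eq_tsum]
    exact (W.summable_generatorBlock ρ).tsum_le_tsum (W.norm_generatorBlock_le hG ρ)
      (W.summable_bound M ρ)
  have h2 : ∑' i, ∑' j, ‖W.R j i‖ ^ 2 * ‖ρ j‖ = ∑' j, ∑' i, ‖W.R j i‖ ^ 2 * ‖ρ j‖ :=
    Summable.tsum_comm (W.summable_jump ρ)
  have h3 : ∑' j, ∑' i, ‖W.R j i‖ ^ 2 * ‖ρ j‖ ≤ ∑' j, M * ‖ρ j‖ := by
    refine Summable.tsum_le_tsum (fun j => ?_) (W.summable_jump ρ).prod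
      ((summable_norm ρ).mul_left M)
    rw [tsum_mul_right]
    exact mul_le_mul_of_nonneg_right (hM j) (norm_nonneg _)
  rw [((summable_norm ρ).mul_left _).tsum_add (W.summable_jump_norm ρ), h2, tsum_mul_left,
    ← norm_eq_tsum] at h1
  rw [tsum_mul_left, ← norm_eq_tsum] at h3
  linarith

/-- The Lindblad generator, a bounded operator on the block diagonal trace-class operators. -/
noncomputable def generator (W : CTOQW V n) : BlockState V n →L[ℂ] BlockState V n :=
  W.generatorLinear.mkContinuousOfExistsBound W.exists_norm_generatorLinear_le

theorem generator_apply (W : CTOQW V n) (ρ : BlockState V n) (i : V) :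
    W.generator ρ i =
      W.G i * ρ i + ρ i * (W.G i)ᴴ + ∑' j, W.R j i * ρ j * (W.R j i)ᴴ :=
  rfl

/-- The uniformly continuous semigroup `e^{tL}` generated by the Lindblad generator `L`. -/
noncomputable def semigroup (W : CTOQW V n) (t : ℝ) : BlockState V n →L[ℂ] BlockState V n :=
  NormedSpace.exp ((t : ℂ) • W.generator)

variable [DecidableEq V]

/-- The state `ρ ⊗ |i⟩⟨i|` concentrated at the vertex `i`. -/
noncomputable def initialState (i : V) (ρ : Matrix n n ℂ) : BlockState V n :=
  lp.single 1 i ρ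

/-- The probability that the walk is at vertex `j` at time `t`, when it starts at vertex `i` with
density `ρ`: the trace of the `j`-th block of `e^{tL} (ρ ⊗ |i⟩⟨i|)`. -/
noncomputable def transitionProb (W : CTOQW V n) (j i : V) (ρ : Matrix n n ℂ) (t : ℝ) : ℝ :=
  (Matrix.trace (W.semigroup t (initialState i ρ) j)).re

end CTOQW

end

open scoped ComplexOrder in
/-- Density matrices on `ℂⁿ`. -/
def IsDensity {n : Type} [Fintype n] (ρ : Matrix n n ℂ) : Prop :=
  ρ.PosSemidef ∧ ρ.trace = 1

namespace CTOQW

section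

variable {V n : Type} [Fintype n] [DecidableEq n] [DecidableEq V]

/-- The mean total time `∫₀^∞ p_{ii;ρ}(t) dt ∈ [0, ∞]` spent at vertex `i` by the walk started at
`i` with density `ρ`. -/
noncomputable def meanOccupation (W : CTOQW V n) (i : V) (ρ : Matrix n n ℂ) : ℝ≥0∞ :=
  ∫⁻ t in Set.Ioi (0 : ℝ), ENNReal.ofReal (W.transitionProb i i ρ t)

/-- Vertex `i` is `ρ`-recurrent. -/
def RhoRecurrent (W : CTOQW V n) (i : V) (ρ : Matrix n n ℂ) : Prop :=
  W.meanOccupation i ρ = ∞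

/-- Vertex `i` is `ρ`-transient. -/
def RhoTransient (W : CTOQW V n) (i : V) (ρ : Matrix n n ℂ) : Prop :=
  W.meanOccupation i ρ < ∞

/-- Vertex `i` is recurrent: it is `ρ`-recurrent for all densities `ρ`. -/
def Recurrent (W : CTOQW V n) (i : V) : Prop :=
  ∀ ρ : Matrix n n ℂ, IsDensity ρ → W.RhoRecurrent i ρ

/-- Vertex `i` is transient: it is `ρ`-transient for all densities `ρ`. -/
def Transient (W : CTOQW V n) (i : V) : Prop :=
  ∀ ρ : Matrix n n ℂ, IsDensity ρ → W.RhoTransient i ρ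

end

end CTOQW

section

open scoped Matrix.Norms.Frobenius

variable {V n : Type} [Fintype n] [DecidableEq n]

/-- The homogeneous nearest-neighbour transitions: `A` for a jump `i → i + 1`, `C` for a jump
`i + 1 → i`, and no other jumps. -/
def nearestNeighbour (V : Type) [Add V] [One V] [DecidableEq V] (A C : Matrix n n ℂ) (i j : V) :
    Matrix n n ℂ :=
  if j = i + 1 then A else if i = j + 1 then C else 0

theorem sum_nearestNeighbour_le [Add V] [One V] [IsRightCancelAdd V] [DecidableEq V]
    (A C : Matrix n n ℂ) (i : V) (s : Finset V) :
    ∑ j ∈ s, ‖nearestNeighbour V A C i j‖ ^ 2 ≤ ‖A‖ ^ 2 + ‖C‖ ^ 2 := by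
  have h1 : ∀ j ∈ s, ‖nearestNeighbour V A C i j‖ ^ 2 ≤
      (if j = i + 1 then ‖A‖ ^ 2 else 0) + (if i = j + 1 then ‖C‖ ^ 2 else 0) := by
    intro j _
    unfold nearestNeighbour
    split_ifs <;> simp
  have h2 : ∑ j ∈ s, (if j = i + 1 then ‖A‖ ^ 2 else 0) ≤ ‖A‖ ^ 2 := by
    rw [Finset.sum_ite_eq']
    split_ifs
    · exact le_rfl
    · positivity
  have h3 : ∑ j ∈ s, (if i = j + 1 then ‖C‖ ^ 2 else 0) ≤ ‖C‖ ^ 2 := by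
    by_cases h : ∃ k, i = k + 1
    · obtain ⟨k, rfl⟩ := h
      have h4 : ∀ j, (k + 1 = j + 1) = (k = j) := fun j => by simp
      simp only [h4]
      rw [Finset.sum_ite_eq]
      split_ifs
      · exact le_rfl
      · positivity
    · push Not at h
      rw [Finset.sum_eq_zero fun j _ => if_neg (h j)]
      positivity
  refine (Finset.sum_le_sum h1).trans ?_
  rw [Finset.sum_add_distrib]
  exact add_le_add h2 h3

/-- The homogeneous nearest-neighbour walk on `V` without Hamiltonian part. -/
def homogeneousWalk (V : Type) [Add V] [One V] [IsRightCancelAdd V] [DecidableEq V]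
    (A C : Matrix n n ℂ) : CTOQW V n where
  H _ := 0
  R := nearestNeighbour V A C
  isHermitian_H _ := Matrix.isHermitian_zero
  bounded_H := ⟨0, fun _ => by simp⟩
  bounded_R := ⟨_, sum_nearestNeighbour_le A C⟩

/-- The homogeneous walk on the half-line `ℤ_{≥0}`; at vertex `0` the only jump is to `1`. -/
def halfLineWalk (A C : Matrix n n ℂ) : CTOQW ℕ n :=
  homogeneousWalk ℕ A C

/-- The homogeneous walk on the line `ℤ`. -/
def lineWalk (A C : Matrix n n ℂ) : CTOQW ℤ n :=
  homogeneousWalk ℤ A C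

end

/-- The diagonal matrix with the real diagonal entries `x`. -/
def realDiagonal {n : Type} [DecidableEq n] (x : n → ℝ) : Matrix n n ℂ :=
  Matrix.diagonal fun k => (x k : ℂ)

end OpenQuantumWalk

/-! ### Continuous functionals on block states, and positivity of the semigroup on diagonal entries.
-/

namespace OpenQuantumWalk

open MeasureTheory Filter Topology
open scoped Matrix.Norms.Frobenius

/-! All transition operators are diagonal, so for each internal direction `k` the numbers `p j = Re
ρ(j) k k` evolve on their own: they solve the Kolmogorov forward equation of a classical birth-death
chain with up-rate `α = a k ^ 2`, down-rate `β = c k ^ 2` and total mass `ρ k k`. The trace sees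
only diagonal entries, and these stay nonnegative, so the occupation integral is finite if and only
if it is finite for every `k`. Hence a vertex is `ρ`-transient exactly when, for every `k`, either
`ρ k k = 0` or the `k`-th chain is transient (`halfLineWalk_rhoTransient_iff`,
`lineWalk_rhoTransient_iff`); the theorem is then a matter of choosing `ρ`.

The classical dichotomy is proved by integrating differential equations. For transience, let `h` be
the probability of ever reaching the starting vertex `i`. The backward generator sends `h` to `-κ`
at `i`, with `κ > 0`, and to `0` elsewhere. So `∑ h j * p j` is nonnegative and decreases at rate `κ
* p i`, which bounds `∫ p i` (`integrableOn_of_potential`).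

For recurrence, suppose `∫ p i` is finite. Integrating the equation at a vertex shows that the
inflow from its neighbours is integrable too (`integrableOn_inflow`), so every `I j = ∫ p j` is
finite and these solve the stationary equation with a source at `i`. On the half-line this reads `β
* I (j + 1) = α * I j - p 0 0`, where `p 0 0` is the initial mass; if `α ≤ β`, then `β * I j` drops
by at least this amount at each step and becomes negative. On the line with `α = β`, `I` is affine
on both sides of `i` with a strictly concave bend at `i`, so it cannot stay nonnegative. -/

theorem norm_entry_le_frobenius {n : Type} [Fintype n] (A : Matrix n n ℂ) (i j : n) :
    ‖A i j‖ ≤ ‖A‖ := by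
  rw [Matrix.frobenius_norm_def, ← Real.sqrt_eq_rpow]
  refine Real.le_sqrt_of_sq_le ?_
  have h1 : ‖A i j‖ ^ 2 ≤ ∑ j, ‖A i j‖ ^ 2 :=
    Finset.single_le_sum (f := fun j => ‖A i j‖ ^ 2) (fun j _ => sq_nonneg _) (Finset.mem_univ j)
  have h2 : ∑ j, ‖A i j‖ ^ 2 ≤ ∑ i, ∑ j, ‖A i j‖ ^ 2 :=
    Finset.single_le_sum (f := fun i => ∑ j, ‖A i j‖ ^ 2)
      (fun i _ => Finset.sum_nonneg fun j _ => sq_nonneg _) (Finset.mem_univ i)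
  exact_mod_cast h1.trans h2

namespace CTOQW

section

variable {V n : Type} [Fintype n] [DecidableEq n]

theorem abs_re_entry_le (x : BlockState V n) (j : V) (k l : n) : |(x j k l).re| ≤ ‖x j‖ :=
  (Complex.abs_re_le_norm _).trans (norm_entry_le_frobenius _ _ _)

theorem norm_mul_re_entry_le {h : V → ℝ} {M : ℝ} (hM : ∀ j, |h j| ≤ M) (x : BlockState V n)
    (j : V) (k : n) : ‖h j * (x j k k).re‖ ≤ M * ‖x j‖ := by
  rw [norm_mul, Real.norm_eq_abs, Real.norm_eq_abs]
  exact mul_le_mul (hM j) (abs_re_entry_le x j k k) (abs_nonneg _) ((abs_nonneg _).trans (hM j))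

theorem summable_mul_re_entry {h : V → ℝ} {M : ℝ} (hM : ∀ j, |h j| ≤ M) (x : BlockState V n)
    (k : n) : Summable fun j => h j * (x j k k).re :=
  Summable.of_norm_bounded ((summable_norm x).mul_left M) fun j => norm_mul_re_entry_le hM x j k

/-- The pairing of a bounded function `h` on the vertices with the `k`-th diagonal entries of the
blocks of a state. -/
noncomputable def diagPairing (k : n) {h : V → ℝ} {M : ℝ} (hM : ∀ j, |h j| ≤ M) :
    BlockState V n →L[ℝ] ℝ :=
  LinearMap.mkContinuous
    { toFun := fun x => ∑' j, h j * (x j k k).re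
      map_add' := fun x y => by
        rw [← (summable_mul_re_entry hM x k).tsum_add (summable_mul_re_entry hM y k)]
        simp [mul_add]
      map_smul' := fun r x => by
        simp only [RingHom.id_apply, smul_eq_mul]
        rw [← tsum_mul_left]
        refine tsum_congr fun j => ?_
        simp
        ring } M
    fun x => by
      rw [norm_eq_tsum, ← tsum_mul_left]
      exact tsum_of_norm_bounded ((summable_norm x).mul_left M).hasSum
        fun j => norm_mul_re_entry_le hM x j k

theorem diagPairing_apply (k : n) {h : V → ℝ} {M : ℝ} (hM : ∀ j, |h j| ≤ M)
    (x : BlockState V n) : diagPairing k hM x = ∑' j, h j * (x j k k).re :=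
  rfl

theorem abs_single_one_le [DecidableEq V] (i j : V) : |(Pi.single i 1 : V → ℝ) j| ≤ 1 := by
  rw [Pi.single_apply]
  split_ifs <;> simp

/-- The real part of the `k`-th diagonal entry of the block at `j`. -/
noncomputable def entryFunctional [DecidableEq V] (j : V) (k : n) : BlockState V n →L[ℝ] ℝ :=
  diagPairing k (abs_single_one_le j)

theorem entryFunctional_apply [DecidableEq V] (j : V) (k : n) (x : BlockState V n) :
    entryFunctional j k x = (x j k k).re := by
  rw [entryFunctional, diagPairing_apply, tsum_eq_single j]
  · simp
  · intro i hi
    simp [hi]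

/-- Completeness is what makes the exponential series of the generator converge; it holds because
the blocks are finite-dimensional. -/
theorem completeSpace_blockState :
    @CompleteSpace (BlockState V n) PseudoMetricSpace.toUniformSpace :=
  haveI : ∀ _ : V, @CompleteSpace (Matrix n n ℂ) PseudoMetricSpace.toUniformSpace := fun _ =>
    FiniteDimensional.complete ℂ (Matrix n n ℂ)
  lp.completeSpace

attribute [local instance] completeSpace_blockState

theorem semigroup_zero (W : CTOQW V n) : W.semigroup 0 = 1 := by
  simp [semigroup, NormedSpace.exp_zero]

theorem hasDerivAt_semigroup_apply (W : CTOQW V n) (x : BlockState V n) (t : ℝ) :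
    HasDerivAt (fun s : ℝ => W.semigroup s x) (W.generator (W.semigroup t x)) t := by
  have h1 := (hasDerivAt_exp_smul_const' (𝕂 := ℂ) W.generator (t : ℂ)).scomp_of_eq t
    Complex.ofRealCLM.hasDerivAt rfl
  have h2 := (((ContinuousLinearMap.apply ℂ (BlockState V n) x).restrictScalars ℝ).hasFDerivAt
    (x := W.semigroup t)).comp_hasDerivAt t h1
  refine HasDerivAt.congr_deriv h2 ?_
  simp [semigroup]

theorem hasDerivAt_pairing_semigroup (W : CTOQW V n) (φ : BlockState V n →L[ℝ] ℝ)
    (x : BlockState V n) (t : ℝ) :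
    HasDerivAt (fun s : ℝ => φ (W.semigroup s x)) (φ (W.generator (W.semigroup t x))) t :=
  (φ.hasFDerivAt (x := W.semigroup t x)).comp_hasDerivAt t (W.hasDerivAt_semigroup_apply x t)

theorem nonneg_pow_apply (B : BlockState V n →L[ℂ] BlockState V n) (k : n)
    (hB : ∀ x : BlockState V n, (∀ j, 0 ≤ (x j k k).re) → ∀ j, 0 ≤ (B x j k k).re)
    (x : BlockState V n) (hx : ∀ j, 0 ≤ (x j k k).re) (m : ℕ) (j : V) :
    0 ≤ ((B ^ m) x j k k).re := by
  induction m generalizing j with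
  | zero => simpa using hx j
  | succ m ih =>
    rw [pow_succ']
    exact hB _ ih j

/-- Every term of the exponential series is a nonnegative multiple of a power of `B`, and powers of
`B` preserve the cone. -/
theorem nonneg_exp_apply [DecidableEq V] (B : BlockState V n →L[ℂ] BlockState V n) (k : n)
    {t : ℝ} (ht : 0 ≤ t)
    (hB : ∀ x : BlockState V n, (∀ j, 0 ≤ (x j k k).re) → ∀ j, 0 ≤ (B x j k k).re)
    (x : BlockState V n) (hx : ∀ j, 0 ≤ (x j k k).re) (j : V) :
    0 ≤ ((NormedSpace.exp ((t : ℂ) • B)) x j k k).re := by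
  have h1 := NormedSpace.exp_series_hasSum_exp' (𝕂 := ℂ) ((t : ℂ) • B)
  have h2 := h1.mapL (((entryFunctional j k).comp
    ((ContinuousLinearMap.apply ℂ (BlockState V n) x).restrictScalars ℝ)))
  simp only [ContinuousLinearMap.comp_apply, entryFunctional_apply,
    ContinuousLinearMap.coe_restrictScalars', ContinuousLinearMap.apply_apply] at h2
  refine h2.nonneg fun m => ?_
  have h3 : (((m.factorial : ℂ)⁻¹ • ((t : ℂ) • B) ^ m) x j k k) =
      (((m.factorial : ℝ)⁻¹ * t ^ m : ℝ) : ℂ) * ((B ^ m) x j k k) := by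
    rw [smul_pow, smul_smul]
    simp
  rw [h3, Complex.re_ofReal_mul]
  have := nonneg_pow_apply B k hB x hx m j
  positivity

/-- If the generator, shifted by a constant, preserves nonnegativity of the `k`-th diagonal
entries, then so does the semigroup. -/
theorem nonneg_semigroup_apply [DecidableEq V] (W : CTOQW V n) (k : n) (κ : ℝ)
    (hW : ∀ x : BlockState V n, (∀ j, 0 ≤ (x j k k).re) →
      ∀ j, 0 ≤ (W.generator x j k k).re + κ * (x j k k).re)
    {t : ℝ} (ht : 0 ≤ t) (x : BlockState V n) (hx : ∀ j, 0 ≤ (x j k k).re) (j : V) :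
    0 ≤ (W.semigroup t x j k k).re := by
  let _ : NormedAlgebra ℚ (BlockState V n →L[ℂ] BlockState V n) :=
    NormedAlgebra.restrictScalars ℚ ℂ _
  -- Scalars commute with the generator, so the shift by `κ` costs only the positive factor
  -- `e^{-tκ}`.
  have h1 : W.semigroup t = ((Real.exp (-(t * κ)) : ℝ) : ℂ) •
      NormedSpace.exp ((t : ℂ) • (W.generator + (κ : ℂ) • 1)) := by
    have h2 : (t : ℂ) • W.generator = algebraMap ℂ _ ((-(t * κ) : ℝ) : ℂ) +
        (t : ℂ) • (W.generator + (κ : ℂ) • 1) := by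
      rw [Algebra.algebraMap_eq_smul_one, smul_add, smul_smul]
      push_cast
      rw [neg_smul]
      abel
    rw [semigroup, h2, NormedSpace.exp_add_of_commute (Algebra.commutes _ _),
      ← NormedSpace.algebraMap_exp_comm, ← Complex.exp_eq_exp_ℂ, Complex.ofReal_exp,
      Algebra.algebraMap_eq_smul_one, smul_mul_assoc, one_mul]
  rw [h1]
  have h3 := nonneg_exp_apply (W.generator + (κ : ℂ) • 1) k ht (fun y hy i => by
    have h5 : (((W.generator + (κ : ℂ) • (1 : BlockState V n →L[ℂ] BlockState V n)) y) i k k) =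
        (W.generator y i k k) + (κ : ℂ) * (y i k k) := rfl
    rw [h5, Complex.add_re, Complex.re_ofReal_mul]
    exact hW y hy i) x hx j
  have h4 := mul_nonneg (Real.exp_nonneg (-(t * κ))) h3
  rw [← Complex.re_ofReal_mul] at h4
  exact h4

end

end CTOQW

end OpenQuantumWalk

/-! ### Time integrals of solutions of birth-death equations. -/

namespace OpenQuantumWalk

open MeasureTheory Filter Topology
open scoped Matrix.Norms.Frobenius

/-- If `f' = g - κ f` with `g ≥ 0` and `f` is bounded and integrable on `(0, ∞)`, then so is `g`,
and integration of the equation gives the value of its integral. -/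
theorem integrableOn_inflow {f g : ℝ → ℝ} {κ M : ℝ} (hκ : 0 ≤ κ)
    (hd : ∀ t, HasDerivAt f (g t - κ * f t) t) (hf : ∀ t, 0 ≤ t → 0 ≤ f t)
    (hg : ∀ t, 0 ≤ t → 0 ≤ g t) (hfM : ∀ t, 0 ≤ t → f t ≤ M)
    (hi : IntegrableOn f (Set.Ioi 0)) :
    IntegrableOn g (Set.Ioi 0) ∧
      ∫ t in Set.Ioi 0, g t = κ * (∫ t in Set.Ioi 0, f t) - f 0 := by
  have hcont : Continuous f := continuous_iff_continuousAt.2 fun t => (hd t).continuousAt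
  -- `f + κ ∫ f` is a primitive of `g`; it is monotone since `g ≥ 0` and bounded by hypothesis,
  -- hence it converges.
  have hF : ∀ t, HasDerivAt (fun t => f t + κ * ∫ s in (0 : ℝ)..t, f s) (g t) t := fun t => by
    have h1 := ((hcont.integral_hasStrictDerivAt 0 t).hasDerivAt).const_mul κ
    exact ((hd t).add h1).congr_deriv (by ring)
  have hmono : MonotoneOn (fun t => f t + κ * ∫ s in (0 : ℝ)..t, f s) (Set.Ici 0) := by
    refine monotoneOn_of_hasDerivWithinAt_nonneg (convex_Ici 0)
      (fun t _ => (hF t).continuousAt.continuousWithinAt)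
      (fun t _ => (hF t).hasDerivWithinAt) fun t ht => hg t ?_
    rw [interior_Ici] at ht
    exact ht.le
  have hbd : ∀ t, 0 ≤ t → f t + κ * (∫ s in (0 : ℝ)..t, f s) ≤
      M + κ * ∫ s in Set.Ioi 0, f s := fun t ht => by
    have h2 : ∫ s in (0 : ℝ)..t, f s ≤ ∫ s in Set.Ioi 0, f s := by
      rw [intervalIntegral.integral_of_le ht]
      refine setIntegral_mono_set hi ?_ Set.Ioc_subset_Ioi_self.eventuallyLE
      exact (ae_restrict_mem measurableSet_Ioi).mono fun s hs => hf s (le_of_lt hs)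
    exact add_le_add (hfM t ht) (mul_le_mul_of_nonneg_left h2 hκ)
  have hgi : IntegrableOn g (Set.Ioi 0) := by
    set F := fun t => f t + κ * ∫ s in (0 : ℝ)..t, f s with hFdef
    -- Signs are known only for `t ≥ 0`; freezing `F` to the left of `0` makes it monotone on all of
    -- `ℝ`.
    have hm : Monotone fun t => F (max t 0) := fun s t hst =>
      hmono (Set.mem_Ici.2 (le_max_right _ _)) (Set.mem_Ici.2 (le_max_right _ _)) (max_le_max hst le_rfl)
    have hb : BddAbove (Set.range fun t => F (max t 0)) :=
      ⟨M + κ * ∫ s in Set.Ioi 0, f s, by rintro _ ⟨t, rfl⟩; exact hbd _ (le_max_right _ _)⟩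
    have ht := tendsto_atTop_ciSup hm hb
    refine integrableOn_Ioi_deriv_of_nonneg' (fun t _ => hF t) (fun t ht => hg t (le_of_lt ht))
      (ht.congr' ?_)
    filter_upwards [eventually_ge_atTop 0] with t h0
    rw [max_eq_left h0]
  have hdi : IntegrableOn (fun t => g t - κ * f t) (Set.Ioi 0) := hgi.sub (hi.const_mul κ)
  -- `f` and `f'` are both integrable, so `f` tends to `0` and the boundary term at infinity
  -- vanishes.
  have h0 := tendsto_zero_of_hasDerivAt_of_integrableOn_Ioi (fun t _ => hd t) hdi hi
  have h3 := integral_Ioi_of_hasDerivAt_of_tendsto' (fun t _ => hd t) hdi h0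
  rw [integral_sub hgi (hi.const_mul κ), integral_const_mul] at h3
  exact ⟨hgi, by linarith⟩

/-- Transience from a bounded potential: if `φ ≥ 0` decreases at rate `κ f ≥ 0`, then `f` is
integrable on `(0, ∞)`. -/
theorem integrableOn_of_potential {f φ : ℝ → ℝ} {κ : ℝ} (hκ : 0 < κ)
    (hd : ∀ t, HasDerivAt φ (-(κ * f t)) t) (hf : ∀ t, 0 ≤ t → 0 ≤ f t)
    (hφ : ∀ t, 0 ≤ t → 0 ≤ φ t) : IntegrableOn f (Set.Ioi 0) := by
  have hanti : AntitoneOn φ (Set.Ici 0) := by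
    refine antitoneOn_of_hasDerivWithinAt_nonpos (convex_Ici 0)
      (fun t _ => (hd t).continuousAt.continuousWithinAt)
      (fun t _ => (hd t).hasDerivWithinAt) fun t ht => ?_
    rw [interior_Ici] at ht
    have := mul_nonneg hκ.le (hf t (le_of_lt ht))
    linarith
  have hm : Antitone fun t => φ (max t 0) := fun s t hst =>
    hanti (Set.mem_Ici.2 (le_max_right _ _)) (Set.mem_Ici.2 (le_max_right _ _)) (max_le_max hst le_rfl)
  have hb : BddBelow (Set.range fun t => φ (max t 0)) :=
    ⟨0, by rintro _ ⟨t, rfl⟩; exact hφ _ (le_max_right _ _)⟩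
  have ht := tendsto_atTop_ciInf hm hb
  have h1 : IntegrableOn (fun t => -(κ * f t)) (Set.Ioi 0) := by
    refine integrableOn_Ioi_deriv_of_nonpos' (fun t _ => hd t) (fun t ht => ?_) (ht.congr' ?_)
    · have := mul_nonneg hκ.le (hf t (le_of_lt ht))
      linarith
    · filter_upwards [eventually_ge_atTop 0] with t h0
      rw [max_eq_left h0]
  have h2 : IntegrableOn (fun t => -κ⁻¹ * -(κ * f t)) (Set.Ioi 0) := h1.const_mul (-κ⁻¹)
  refine h2.congr_fun (fun t _ => ?_) measurableSet_Ioi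
  simp only
  field_simp

/-- A summand of a nonnegative integrable function is integrable. -/
theorem integrableOn_of_mul_le {f g : ℝ → ℝ} {r : ℝ} (hr : 0 < r) (hfc : Continuous f)
    (hf : ∀ t, 0 ≤ t → 0 ≤ f t) (hfg : ∀ t, 0 ≤ t → r * f t ≤ g t)
    (hg : IntegrableOn g (Set.Ioi 0)) : IntegrableOn f (Set.Ioi 0) := by
  refine Integrable.mono' (hg.const_mul r⁻¹) hfc.aestronglyMeasurable ?_
  refine (ae_restrict_mem measurableSet_Ioi).mono fun t ht => ?_
  have h1 := hf t (le_of_lt ht)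
  have h2 := hfg t (le_of_lt ht)
  rw [Real.norm_eq_abs, abs_of_nonneg h1, inv_mul_eq_div, le_div_iff₀ hr]
  linarith

/-- The occupation densities of a recurrent birth-death chain on `ℕ`, started at `0`, are not
integrable. -/
theorem not_integrableOn_birthDeath_nat {u : ℕ → ℝ → ℝ} {α β M : ℝ} (hα : 0 < α) (hαβ : α ≤ β)
    (hd0 : ∀ t, HasDerivAt (u 0) (-α * u 0 t + β * u 1 t) t)
    (hd : ∀ j t, HasDerivAt (u (j + 1))
      (-(α + β) * u (j + 1) t + α * u j t + β * u (j + 2) t) t)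
    (hu : ∀ j t, 0 ≤ t → 0 ≤ u j t) (huM : ∀ j t, 0 ≤ t → u j t ≤ M)
    (h0 : 0 < u 0 0) (hj : ∀ j, u (j + 1) 0 = 0) : ¬ IntegrableOn (u 0) (Set.Ioi 0) := by
  intro hi
  have hβ : 0 < β := hα.trans_le hαβ
  have hc : ∀ j, Continuous (u j) := by
    rintro (_ | j)
    · exact continuous_iff_continuousAt.2 fun t => (hd0 t).continuousAt
    · exact continuous_iff_continuousAt.2 fun t => (hd j t).continuousAt
  -- The identity says that the net flow across the edge from `j` to `j + 1`, over all time, equals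
  -- the initial mass at `0`: everything must leave `0, …, j` if the occupation integrals are
  -- finite.
  have key : ∀ j, IntegrableOn (u j) (Set.Ioi 0) ∧ IntegrableOn (u (j + 1)) (Set.Ioi 0) ∧
      β * (∫ t in Set.Ioi 0, u (j + 1) t) = α * (∫ t in Set.Ioi 0, u j t) - u 0 0 := by
    intro j
    induction j with
    | zero =>
      obtain ⟨h1, h2⟩ := integrableOn_inflow (f := u 0) (g := fun t => β * u 1 t) hα.le
        (fun t => (hd0 t).congr_deriv (by ring)) (hu 0)
        (fun t ht => mul_nonneg hβ.le (hu 1 t ht)) (huM 0) hi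
      refine ⟨hi, integrableOn_of_mul_le hβ (hc 1) (hu 1) (fun t _ => le_rfl) h1, ?_⟩
      rw [integral_const_mul] at h2
      exact h2
    | succ j ih =>
      obtain ⟨i1, i2, i3⟩ := ih
      obtain ⟨h1, h2⟩ := integrableOn_inflow (f := u (j + 1))
        (g := fun t => α * u j t + β * u (j + 2) t) (add_pos hα hβ).le
        (fun t => (hd j t).congr_deriv (by ring)) (hu (j + 1))
        (fun t ht => add_nonneg (mul_nonneg hα.le (hu j t ht)) (mul_nonneg hβ.le (hu _ t ht)))
        (huM _) i2
      have h3 : IntegrableOn (u (j + 2)) (Set.Ioi 0) :=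
        integrableOn_of_mul_le hβ (hc _) (hu _)
          (fun t ht => le_add_of_nonneg_left (mul_nonneg hα.le (hu j t ht))) h1
      refine ⟨i2, h3, ?_⟩
      rw [integral_add (i1.const_mul α) (h3.const_mul β), integral_const_mul, integral_const_mul,
        hj j] at h2
      show β * (∫ t in Set.Ioi 0, u (j + 2) t) = _
      linarith
  have hI : ∀ j, 0 ≤ ∫ t in Set.Ioi 0, u j t := fun j =>
    setIntegral_nonneg measurableSet_Ioi fun t ht => hu j t (le_of_lt ht)
  have hdec : ∀ j : ℕ, β * (∫ t in Set.Ioi 0, u j t) ≤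
      β * (∫ t in Set.Ioi 0, u 0 t) - j * u 0 0 := by
    intro j
    induction j with
    | zero => simp
    | succ j ih =>
      rw [(key j).2.2]
      have := mul_le_mul_of_nonneg_right hαβ (hI j)
      push_cast
      linarith
  obtain ⟨j, hj'⟩ := exists_nat_gt (β * (∫ t in Set.Ioi 0, u 0 t) / u 0 0)
  rw [div_lt_iff₀ h0] at hj'
  have h5 := hdec j
  have h6 := mul_nonneg hβ.le (hI j)
  linarith

/-- A nonnegative function on `ℤ` that is concave, with a strict bend at one point, does not
exist. -/
theorem false_of_concave_int {I : ℤ → ℝ} {i : ℤ} {δ : ℝ} (hδ : 0 < δ) (hI : ∀ j, 0 ≤ I j)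
    (hi : I (i + 1) + I (i - 1) - 2 * I i = -δ)
    (hj : ∀ j, j ≠ i → I (j + 1) + I (j - 1) - 2 * I j = 0) : False := by
  -- Second differences vanish away from `i`, so the increments are constant on each side.
  have hr : ∀ m : ℕ, I (i + m + 1) - I (i + m) = I (i + 1) - I i := by
    intro m
    induction m with
    | zero => simp
    | succ m ih =>
      have h1 := hj (i + (m + 1 : ℕ)) (by push_cast; omega)
      have h2 : i + ((m + 1 : ℕ) : ℤ) - 1 = i + m := by push_cast; ring
      have h3 : i + ((m + 1 : ℕ) : ℤ) = i + m + 1 := by push_cast; ring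
      rw [h2] at h1
      rw [h3] at h1 ⊢
      linarith
  have hl : ∀ m : ℕ, I (i - m - 1) - I (i - m) = I (i - 1) - I i := by
    intro m
    induction m with
    | zero => simp
    | succ m ih =>
      have h1 := hj (i - (m + 1 : ℕ)) (by push_cast; omega)
      have h2 : i - ((m + 1 : ℕ) : ℤ) + 1 = i - m := by push_cast; ring
      have h3 : i - ((m + 1 : ℕ) : ℤ) = i - m - 1 := by push_cast; ring
      rw [h2] at h1
      rw [h3] at h1 ⊢
      linarith
  have hr' : ∀ m : ℕ, I (i + m) = I i + m * (I (i + 1) - I i) := by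
    intro m
    induction m with
    | zero => simp
    | succ m ih =>
      have := hr m
      push_cast
      rw [← add_assoc]
      linarith
  have hl' : ∀ m : ℕ, I (i - m) = I i + m * (I (i - 1) - I i) := by
    intro m
    induction m with
    | zero => simp
    | succ m ih =>
      have := hl m
      push_cast
      rw [← sub_sub]
      linarith
  have hneg : ∀ d : ℝ, (∀ m : ℕ, 0 ≤ I i + m * d) → 0 ≤ d := by
    intro d hd
    by_contra! h
    obtain ⟨m, hm⟩ := exists_nat_gt (I i / -d)
    rw [div_lt_iff₀ (by linarith)] at hm
    have := hd m
    linarith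
  -- Both outward slopes are nonnegative, yet by `hi` their sum is `-δ < 0`.
  have h1 := hneg _ fun m => (hr' m) ▸ hI _
  have h2 := hneg _ fun m => (hl' m) ▸ hI _
  linarith

/-- The occupation densities of a symmetric birth-death chain on `ℤ` are not integrable. -/
theorem not_integrableOn_birthDeath_int {u : ℤ → ℝ → ℝ} {α M : ℝ} {i : ℤ} (hα : 0 < α)
    (hd : ∀ j t, HasDerivAt (u j) (-(α + α) * u j t + α * u (j - 1) t + α * u (j + 1) t) t)
    (hu : ∀ j t, 0 ≤ t → 0 ≤ u j t) (huM : ∀ j t, 0 ≤ t → u j t ≤ M)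
    (h0 : 0 < u i 0) (hj : ∀ j, j ≠ i → u j 0 = 0) : ¬ IntegrableOn (u i) (Set.Ioi 0) := by
  intro hi
  have hc : ∀ j, Continuous (u j) := fun j =>
    continuous_iff_continuousAt.2 fun t => (hd j t).continuousAt
  have hpos : ∀ j t, 0 ≤ t → 0 ≤ α * u j t := fun j t ht => mul_nonneg hα.le (hu j t ht)
  have flow : ∀ j, IntegrableOn (u j) (Set.Ioi 0) →
      IntegrableOn (fun t => α * u (j - 1) t + α * u (j + 1) t) (Set.Ioi 0) ∧
      ∫ t in Set.Ioi 0, (α * u (j - 1) t + α * u (j + 1) t) =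
        (α + α) * (∫ t in Set.Ioi 0, u j t) - u j 0 := fun j hij =>
    integrableOn_inflow (add_pos hα hα).le (fun t => (hd j t).congr_deriv (by ring)) (hu j)
      (fun t ht => add_nonneg (hpos _ t ht) (hpos _ t ht)) (huM j) hij
  -- Integrability spreads from `i` in both directions, since each neighbour is dominated by an
  -- integrable inflow.
  have hall : ∀ j, IntegrableOn (u j) (Set.Ioi 0) := by
    intro j
    induction j using Int.inductionOn' (b := i) with
    | zero => exact hi
    | succ k _ ih =>
      exact integrableOn_of_mul_le hα (hc _) (hu _)
        (fun t ht => le_add_of_nonneg_left (hpos _ t ht)) (flow k ih).1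
    | pred k _ ih =>
      exact integrableOn_of_mul_le hα (hc _) (hu _)
        (fun t ht => le_add_of_nonneg_right (hpos _ t ht)) (flow k ih).1
  have hbal : ∀ j, α * (∫ t in Set.Ioi 0, u (j - 1) t) + α * (∫ t in Set.Ioi 0, u (j + 1) t) =
      (α + α) * (∫ t in Set.Ioi 0, u j t) - u j 0 := fun j => by
    have h1 := (flow j (hall j)).2
    rwa [integral_add ((hall _).const_mul α) ((hall _).const_mul α), integral_const_mul,
      integral_const_mul] at h1
  refine false_of_concave_int (I := fun j => α * ∫ t in Set.Ioi 0, u j t) h0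
    (fun j => mul_nonneg hα.le (setIntegral_nonneg measurableSet_Ioi
      fun t ht => hu j t (le_of_lt ht))) (i := i) ?_ fun j hji => ?_
  · have := hbal i
    linarith
  · have := hbal j
    rw [hj j hji] at this
    linarith

end OpenQuantumWalk

/-! ### The generators on diagonal entries: birth-death equations. -/

namespace OpenQuantumWalk

open scoped Matrix.Norms.Frobenius

theorem tsum_eq_add_of_support {V E : Type} [AddCommMonoid E] [TopologicalSpace E] {f : V → E}
    {p q : V} (hpq : p ≠ q) (hf : ∀ j, j ≠ p → j ≠ q → f j = 0) : ∑' j, f j = f p + f q := by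
  classical
  rw [tsum_eq_sum (s := {p, q}) fun j hj => ?_, Finset.sum_pair hpq]
  simp only [Finset.mem_insert, Finset.mem_singleton, not_or] at hj
  exact hf j hj.1 hj.2

section

variable {n : Type} [Fintype n] [DecidableEq n]

theorem realDiagonal_conj_entry (a : n → ℝ) (X : Matrix n n ℂ) (k : n) :
    ((realDiagonal a * X * (realDiagonal a)ᴴ) k k).re = a k ^ 2 * (X k k).re := by
  rw [realDiagonal, Matrix.diagonal_conjTranspose, Matrix.mul_diagonal, Matrix.diagonal_mul]
  simp
  ring

/-- Each of the two factors contributes `-d k / 2`. The vanishing Hamiltonian is kept so that the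
left side matches the unfolded `CTOQW.G`. -/
theorem realDiagonal_dissipator_entry (d : n → ℝ) (X : Matrix n n ℂ) (k : n) :
    ((-(Complex.I • (0 : Matrix n n ℂ)) - (1 / 2 : ℂ) • realDiagonal d) * X +
      X * (-(Complex.I • (0 : Matrix n n ℂ)) - (1 / 2 : ℂ) • realDiagonal d)ᴴ) k k =
      -(d k * X k k) := by
  have h1 : -(Complex.I • (0 : Matrix n n ℂ)) - (1 / 2 : ℂ) • realDiagonal d =
      Matrix.diagonal fun k => ((-(d k / 2) : ℝ) : ℂ) := by
    ext i j
    by_cases h : i = j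
    · subst h
      simp [realDiagonal]
      ring
    · simp [realDiagonal, h]
  rw [h1, Matrix.diagonal_conjTranspose, Matrix.add_apply, Matrix.mul_diagonal,
    Matrix.diagonal_mul]
  simp
  ring

theorem realDiagonal_conjTranspose_mul_self (a : n → ℝ) :
    (realDiagonal a)ᴴ * realDiagonal a = realDiagonal fun k => a k ^ 2 := by
  rw [realDiagonal, Matrix.diagonal_conjTranspose, Matrix.diagonal_mul_diagonal, realDiagonal]
  congr 1
  ext k
  simp
  ring

theorem realDiagonal_add {m : Type} [DecidableEq m] (a c : m → ℝ) :
    realDiagonal a + realDiagonal c = realDiagonal fun k => a k + c k := by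
  rw [realDiagonal, realDiagonal, Matrix.diagonal_add, realDiagonal]
  simp

theorem halfLineWalk_generator_zero (a c : n → ℝ) (x : BlockState ℕ n) (k : n) :
    ((halfLineWalk (realDiagonal a) (realDiagonal c)).generator x 0 k k).re =
      -(a k ^ 2) * (x 0 k k).re + c k ^ 2 * (x 1 k k).re := by
  rw [CTOQW.generator_apply]
  simp only [CTOQW.G, halfLineWalk, homogeneousWalk]
  -- Vertex `0` is not of the form `j + 1` in `ℕ`, so its only neighbour is `1`, both for outgoing
  -- and for incoming jumps.
  rw [tsum_eq_single 1 fun j hj => by simp [nearestNeighbour, hj],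
    tsum_eq_single 1 fun j hj => by simp [nearestNeighbour, hj]]
  simp only [nearestNeighbour, zero_add, if_true, if_false,
    Nat.reduceAdd, Nat.reduceEqDiff, realDiagonal_conjTranspose_mul_self]
  rw [Matrix.add_apply, Complex.add_re, realDiagonal_dissipator_entry,
    realDiagonal_conj_entry, Complex.neg_re, Complex.re_ofReal_mul, neg_mul]

theorem halfLineWalk_generator_succ (a c : n → ℝ) (x : BlockState ℕ n) (j : ℕ) (k : n) :
    ((halfLineWalk (realDiagonal a) (realDiagonal c)).generator x (j + 1) k k).re =
      -(a k ^ 2 + c k ^ 2) * (x (j + 1) k k).re + a k ^ 2 * (x j k k).re +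
        c k ^ 2 * (x (j + 2) k k).re := by
  rw [CTOQW.generator_apply]
  simp only [CTOQW.G, halfLineWalk, homogeneousWalk]
  have h1 : nearestNeighbour ℕ (realDiagonal a) (realDiagonal c) (j + 1) (j + 2) =
    realDiagonal a := by simp [nearestNeighbour]
  have h2 : nearestNeighbour ℕ (realDiagonal a) (realDiagonal c) (j + 1) j =
    realDiagonal c := by rw [nearestNeighbour, if_neg (by omega), if_pos (by omega)]
  have h3 : nearestNeighbour ℕ (realDiagonal a) (realDiagonal c) j (j + 1) =
    realDiagonal a := by simp [nearestNeighbour]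
  have h4 : nearestNeighbour ℕ (realDiagonal a) (realDiagonal c) (j + 2) (j + 1) =
    realDiagonal c := by rw [nearestNeighbour, if_neg (by omega), if_pos (by omega)]
  have h5 : ∀ i, i ≠ j + 2 → i ≠ j →
      nearestNeighbour ℕ (realDiagonal a) (realDiagonal c) (j + 1) i = 0 := fun i hi hi' => by
    rw [nearestNeighbour, if_neg (by omega), if_neg (by omega)]
  have h6 : ∀ i, i ≠ j → i ≠ j + 2 →
      nearestNeighbour ℕ (realDiagonal a) (realDiagonal c) i (j + 1) = 0 := fun i hi hi' => by
    rw [nearestNeighbour, if_neg (by omega), if_neg (by omega)]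
  rw [tsum_eq_add_of_support (p := j + 2) (q := j) (by omega) fun i hi hi' => by
      rw [h5 i hi hi', Matrix.mul_zero],
    tsum_eq_add_of_support (p := j) (q := j + 2) (by omega) fun i hi hi' => by
      rw [h6 i hi hi', Matrix.zero_mul, Matrix.zero_mul],
    h1, h2, h3, h4, realDiagonal_conjTranspose_mul_self, realDiagonal_conjTranspose_mul_self,
    realDiagonal_add, Matrix.add_apply, Complex.add_re, realDiagonal_dissipator_entry,
    Matrix.add_apply, Complex.add_re, realDiagonal_conj_entry, realDiagonal_conj_entry,
    Complex.neg_re, Complex.re_ofReal_mul]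
  ring

theorem lineWalk_generator (a c : n → ℝ) (x : BlockState ℤ n) (j : ℤ) (k : n) :
    ((lineWalk (realDiagonal a) (realDiagonal c)).generator x j k k).re =
      -(a k ^ 2 + c k ^ 2) * (x j k k).re + a k ^ 2 * (x (j - 1) k k).re +
        c k ^ 2 * (x (j + 1) k k).re := by
  rw [CTOQW.generator_apply]
  simp only [CTOQW.G, lineWalk, homogeneousWalk]
  have h1 : nearestNeighbour ℤ (realDiagonal a) (realDiagonal c) j (j + 1) =
    realDiagonal a := by simp [nearestNeighbour]
  have h2 : nearestNeighbour ℤ (realDiagonal a) (realDiagonal c) j (j - 1) =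
    realDiagonal c := by rw [nearestNeighbour, if_neg (by omega), if_pos (by omega)]
  have h3 : nearestNeighbour ℤ (realDiagonal a) (realDiagonal c) (j - 1) j =
    realDiagonal a := by simp [nearestNeighbour]
  have h4 : nearestNeighbour ℤ (realDiagonal a) (realDiagonal c) (j + 1) j =
    realDiagonal c := by rw [nearestNeighbour, if_neg (by omega), if_pos (by omega)]
  have h5 : ∀ i, i ≠ j + 1 → i ≠ j - 1 →
      nearestNeighbour ℤ (realDiagonal a) (realDiagonal c) j i = 0 := fun i hi hi' => by
    rw [nearestNeighbour, if_neg (by omega), if_neg (by omega)]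
  have h6 : ∀ i, i ≠ j - 1 → i ≠ j + 1 →
      nearestNeighbour ℤ (realDiagonal a) (realDiagonal c) i j = 0 := fun i hi hi' => by
    rw [nearestNeighbour, if_neg (by omega), if_neg (by omega)]
  rw [tsum_eq_add_of_support (p := j + 1) (q := j - 1) (by omega) fun i hi hi' => by
      rw [h5 i hi hi', Matrix.mul_zero],
    tsum_eq_add_of_support (p := j - 1) (q := j + 1) (by omega) fun i hi hi' => by
      rw [h6 i hi hi', Matrix.zero_mul, Matrix.zero_mul],
    h1, h2, h3, h4, realDiagonal_conjTranspose_mul_self, realDiagonal_conjTranspose_mul_self,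
    realDiagonal_add, Matrix.add_apply, Complex.add_re, realDiagonal_dissipator_entry,
    Matrix.add_apply, Complex.add_re, realDiagonal_conj_entry, realDiagonal_conj_entry,
    Complex.neg_re, Complex.re_ofReal_mul]
  ring

end

end OpenQuantumWalk

/-! ### Occupation of single entries, and pairing the generator with bounded functions. -/

namespace OpenQuantumWalk

open MeasureTheory Filter Topology
open scoped Matrix.Norms.Frobenius

namespace CTOQW

section

variable {V n : Type} [Fintype n] [DecidableEq n] [DecidableEq V]

theorem hasDerivAt_entry_semigroup (W : CTOQW V n) (x : BlockState V n) (j : V) (k : n) (t : ℝ) :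
    HasDerivAt (fun s : ℝ => (W.semigroup s x j k k).re)
      (W.generator (W.semigroup t x) j k k).re t := by
  simpa only [entryFunctional_apply] using
    W.hasDerivAt_pairing_semigroup (entryFunctional j k) x t

theorem continuous_entry_semigroup (W : CTOQW V n) (x : BlockState V n) (j : V) (k : n) :
    Continuous fun s : ℝ => (W.semigroup s x j k k).re :=
  continuous_iff_continuousAt.2 fun t => (W.hasDerivAt_entry_semigroup x j k t).continuousAt

theorem initialState_self (i : V) (ρ : Matrix n n ℂ) : initialState i ρ i = ρ := by
  simp [initialState]

theorem initialState_of_ne {i j : V} (h : j ≠ i) (ρ : Matrix n n ℂ) : initialState i ρ j = 0 := by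
  simp [initialState, lp.single_apply, h]

theorem re_initialState_nonneg (i : V) {ρ : Matrix n n ℂ} {k : n} (hρ : 0 ≤ (ρ k k).re) (j : V) :
    0 ≤ (initialState i ρ j k k).re := by
  by_cases h : j = i
  · subst h
    rwa [initialState_self]
  · simp [initialState_of_ne h]

/-- A diagonal entry that vanishes initially vanishes forever. -/
theorem entry_semigroup_eq_zero (W : CTOQW V n) (k : n) (κ : ℝ)
    (hW : ∀ x : BlockState V n, (∀ j, 0 ≤ (x j k k).re) →
      ∀ j, 0 ≤ (W.generator x j k k).re + κ * (x j k k).re)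
    {t : ℝ} (ht : 0 ≤ t) (x : BlockState V n) (hx : ∀ j, (x j k k).re = 0) (j : V) :
    (W.semigroup t x j k k).re = 0 := by
  have h1 := W.nonneg_semigroup_apply k κ hW ht x (fun j => (hx j).ge) j
  have h2 := W.nonneg_semigroup_apply k κ hW ht (-x) (fun j => by simp [hx j]) j
  rw [map_neg] at h2
  have h3 : ((-(W.semigroup t x)) j k k).re = -(W.semigroup t x j k k).re := by simp
  linarith

/-- If the total mass of the `k`-th diagonal entries is conserved, then each of these entries
is bounded by the initial mass. -/
theorem entry_semigroup_le (W : CTOQW V n) (k : n) (κ : ℝ)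
    (hW : ∀ x : BlockState V n, (∀ j, 0 ≤ (x j k k).re) →
      ∀ j, 0 ≤ (W.generator x j k k).re + κ * (x j k k).re)
    (hmass : ∀ x : BlockState V n, ∑' j, (W.generator x j k k).re = 0)
    {t : ℝ} (ht : 0 ≤ t) (x : BlockState V n) (hx : ∀ j, 0 ≤ (x j k k).re) (j : V) :
    (W.semigroup t x j k k).re ≤ ∑' j, (x j k k).re := by
  have hM : ∀ j : V, |(1 : ℝ)| ≤ 1 := fun _ => by simp
  have h1 : ∀ y : BlockState V n, diagPairing k hM y = ∑' j, (y j k k).re := fun y => by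
    rw [diagPairing_apply]
    simp
  have h2 : ∀ s, HasDerivAt (fun s : ℝ => diagPairing k hM (W.semigroup s x)) 0 s := fun s =>
    (W.hasDerivAt_pairing_semigroup (diagPairing k hM) x s).congr_deriv (by rw [h1, hmass])
  -- The total mass is constant in time, and a single nonnegative entry is at most the total.
  have h3 := is_const_of_deriv_eq_zero (fun s => (h2 s).differentiableAt) (fun s => (h2 s).deriv)
    t 0
  simp only [h1, semigroup_zero, one_apply_eq_self] at h3
  rw [← h3]
  have h4 : Summable fun j => (W.semigroup t x j k k).re := by
    simpa using summable_mul_re_entry hM (W.semigroup t x) k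
  exact h4.le_tsum j fun i _ => W.nonneg_semigroup_apply k κ hW ht x hx i

theorem transitionProb_eq_sum (W : CTOQW V n) (j i : V) (ρ : Matrix n n ℂ) (t : ℝ) :
    W.transitionProb j i ρ t = ∑ k, (W.semigroup t (initialState i ρ) j k k).re := by
  simp [transitionProb, Matrix.trace]

/-- Transience means that the occupation densities of all diagonal entries are integrable. -/
theorem rhoTransient_iff_integrableOn (W : CTOQW V n) (i : V) (ρ : Matrix n n ℂ)
    (h0 : ∀ k t, 0 ≤ t → 0 ≤ (W.semigroup t (initialState i ρ) i k k).re) :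
    W.RhoTransient i ρ ↔ ∀ k, IntegrableOn
      (fun t : ℝ => (W.semigroup t (initialState i ρ) i k k).re) (Set.Ioi 0) := by
  have hc : Continuous (W.transitionProb i i ρ) := by
    have h1 : W.transitionProb i i ρ = fun t =>
        ∑ k, (W.semigroup t (initialState i ρ) i k k).re := funext (W.transitionProb_eq_sum i i ρ)
    rw [h1]
    exact continuous_finsetSum _ fun k _ => W.continuous_entry_semigroup _ i k
  have hp : 0 ≤ᵐ[volume.restrict (Set.Ioi 0)] W.transitionProb i i ρ := by
    refine (ae_restrict_mem measurableSet_Ioi).mono fun t ht => ?_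
    rw [Pi.zero_apply, W.transitionProb_eq_sum]
    exact Finset.sum_nonneg fun k _ => h0 k t (le_of_lt ht)
  have h2 : W.RhoTransient i ρ ↔ IntegrableOn (W.transitionProb i i ρ) (Set.Ioi 0) := by
    rw [RhoTransient, meanOccupation, IntegrableOn, Integrable, hasFiniteIntegral_iff_ofReal hp]
    exact (and_iff_right hc.aestronglyMeasurable).symm
  rw [h2]
  constructor
  · intro h k
    refine Integrable.mono' h (W.continuous_entry_semigroup _ i k).aestronglyMeasurable ?_
    refine (ae_restrict_mem measurableSet_Ioi).mono fun t ht => ?_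
    rw [Real.norm_eq_abs, abs_of_nonneg (h0 k t (le_of_lt ht)), W.transitionProb_eq_sum]
    exact Finset.single_le_sum (f := fun k => (W.semigroup t (initialState i ρ) i k k).re)
      (fun k _ => h0 k t (le_of_lt ht)) (Finset.mem_univ k)
  · intro h
    have h1 : W.transitionProb i i ρ = fun t =>
        ∑ k, (W.semigroup t (initialState i ρ) i k k).re := funext (W.transitionProb_eq_sum i i ρ)
    rw [h1]
    exact integrable_finsetSum _ fun k _ => h k

end

end CTOQW

section

variable {n : Type} [Fintype n] [DecidableEq n]

/-- Summation by parts: `a k ^ 2 * x j - c k ^ 2 * x (j + 1)` is the net current across the edge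
from `j` to `j + 1`, and the generator at a vertex is the incoming minus the outgoing current, with
no incoming current at `0`. -/
theorem halfLineWalk_pairing_generator (a c : n → ℝ) (k : n) {h : ℕ → ℝ} {M : ℝ}
    (hM : ∀ j, |h j| ≤ M) (x : BlockState ℕ n) :
    Summable (fun j => (h (j + 1) - h j) *
      (a k ^ 2 * (x j k k).re - c k ^ 2 * (x (j + 1) k k).re)) ∧
    ∑' j, h j * ((halfLineWalk (realDiagonal a) (realDiagonal c)).generator x j k k).re =
      ∑' j, (h (j + 1) - h j) *
        (a k ^ 2 * (x j k k).re - c k ^ 2 * (x (j + 1) k k).re) := by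
  set z : ℕ → ℝ := fun j => a k ^ 2 * (x j k k).re - c k ^ 2 * (x (j + 1) k k).re with hz
  have hs : ∀ g : ℕ → ℝ, (∀ j, |g j| ≤ M) → Summable fun j => g j * z j := by
    intro g hg
    have h1 := (CTOQW.summable_mul_re_entry hg x k).mul_left (a k ^ 2)
    -- The weight is `g (j - 1)` so that the shift by one leaves `g j * x (j + 1)`; the truncated
    -- value at `j = 0` is dropped by the shift.
    have h2 := (summable_nat_add_iff 1).2
      (CTOQW.summable_mul_re_entry (h := fun j => g (j - 1)) (fun j => hg _) x k)
    refine (h1.sub (h2.mul_left (c k ^ 2))).congr fun j => ?_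
    simp only [hz, Nat.add_sub_cancel]
    ring
  have h1 := hs h hM
  have h2 := hs (fun j => h (j + 1)) fun j => hM _
  have h3 := (summable_nat_add_iff 1).2 h1
  have hy := CTOQW.summable_mul_re_entry hM
    ((halfLineWalk (realDiagonal a) (realDiagonal c)).generator x) k
  have h4 : ∑' j, h j * z j = h 0 * z 0 + ∑' j, h (j + 1) * z (j + 1) := h1.tsum_eq_zero_add
  have h5 : ∀ j, h (j + 1) *
      ((halfLineWalk (realDiagonal a) (realDiagonal c)).generator x (j + 1) k k).re =
      h (j + 1) * z j - h (j + 1) * z (j + 1) := fun j => by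
    rw [halfLineWalk_generator_succ]
    simp only [hz]
    ring
  have h6 : ∀ j, (h (j + 1) - h j) * z j = h (j + 1) * z j - h j * z j := fun j => by ring
  refine ⟨(h2.sub h1).congr fun j => (h6 j).symm, ?_⟩
  rw [hy.tsum_eq_zero_add, tsum_congr h5, h2.tsum_sub h3, tsum_congr h6, h2.tsum_sub h1, h4,
    halfLineWalk_generator_zero]
  simp only [hz, zero_add]
  ring

/-- Translating the two jump sums by one moves the generator onto `h`, where it becomes the backward
generator of the chain. -/
theorem lineWalk_pairing_generator (a c : n → ℝ) (k : n) {h : ℤ → ℝ} {M : ℝ}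
    (hM : ∀ j, |h j| ≤ M) (x : BlockState ℤ n) :
    ∑' j, h j * ((lineWalk (realDiagonal a) (realDiagonal c)).generator x j k k).re =
      ∑' j, (-(a k ^ 2 + c k ^ 2) * h j + a k ^ 2 * h (j + 1) + c k ^ 2 * h (j - 1)) *
        (x j k k).re := by
  have h1 := (CTOQW.summable_mul_re_entry hM x k).mul_left (-(a k ^ 2 + c k ^ 2))
  have h2 := (CTOQW.summable_mul_re_entry (h := fun j => h (j + 1)) (fun j => hM _) x k).mul_left
    (a k ^ 2)
  have h3 := (CTOQW.summable_mul_re_entry (h := fun j => h (j - 1)) (fun j => hM _) x k).mul_left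
    (c k ^ 2)
  have e2 := (Equiv.subRight (1 : ℤ)).tsum_eq fun j => a k ^ 2 * (h (j + 1) * (x j k k).re)
  have e3 := (Equiv.addRight (1 : ℤ)).tsum_eq fun j => c k ^ 2 * (h (j - 1) * (x j k k).re)
  have s2 := (Equiv.subRight (1 : ℤ)).summable_iff.2 h2
  have s3 := (Equiv.addRight (1 : ℤ)).summable_iff.2 h3
  simp only [Function.comp_def, Equiv.subRight_apply, Equiv.coe_addRight, sub_add_cancel,
    add_sub_cancel_right] at e2 e3 s2 s3
  have h4 : ∀ j, h j * ((lineWalk (realDiagonal a) (realDiagonal c)).generator x j k k).re =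
      -(a k ^ 2 + c k ^ 2) * (h j * (x j k k).re) + a k ^ 2 * (h j * (x (j - 1) k k).re) +
        c k ^ 2 * (h j * (x (j + 1) k k).re) := fun j => by
    rw [lineWalk_generator]
    ring
  have h5 : ∀ j, (-(a k ^ 2 + c k ^ 2) * h j + a k ^ 2 * h (j + 1) + c k ^ 2 * h (j - 1)) *
      (x j k k).re = -(a k ^ 2 + c k ^ 2) * (h j * (x j k k).re) +
        a k ^ 2 * (h (j + 1) * (x j k k).re) + c k ^ 2 * (h (j - 1) * (x j k k).re) :=
    fun j => by ring
  rw [tsum_congr h4, tsum_congr h5, (h1.add s2).tsum_add s3, h1.tsum_add s2,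
    (h1.add h2).tsum_add h3, h1.tsum_add h2, e2, e3]

end

end OpenQuantumWalk

/-! ### Transience criteria for the half-line and the line. -/

namespace OpenQuantumWalk

open MeasureTheory Filter Topology
open scoped Matrix.Norms.Frobenius ComplexOrder

section

variable {n : Type} [Fintype n] [DecidableEq n]

/-- The only negative term of the generator is the exit rate. The shift `a k ^ 2 + c k ^ 2`
compensates it at every vertex, with a surplus at `0`. -/
theorem halfLineWalk_quasiPositive (a c : n → ℝ) (k : n) (x : BlockState ℕ n)
    (hx : ∀ j, 0 ≤ (x j k k).re) (j : ℕ) :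
    0 ≤ ((halfLineWalk (realDiagonal a) (realDiagonal c)).generator x j k k).re +
      (a k ^ 2 + c k ^ 2) * (x j k k).re := by
  rcases j with _ | j
  · rw [halfLineWalk_generator_zero]
    have h0 := mul_nonneg (sq_nonneg (c k)) (hx 0)
    have h1 := mul_nonneg (sq_nonneg (c k)) (hx 1)
    linarith
  · rw [halfLineWalk_generator_succ]
    have h0 := mul_nonneg (sq_nonneg (a k)) (hx j)
    have h1 := mul_nonneg (sq_nonneg (c k)) (hx (j + 2))
    linarith

theorem lineWalk_quasiPositive (a c : n → ℝ) (k : n) (x : BlockState ℤ n)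
    (hx : ∀ j, 0 ≤ (x j k k).re) (j : ℤ) :
    0 ≤ ((lineWalk (realDiagonal a) (realDiagonal c)).generator x j k k).re +
      (a k ^ 2 + c k ^ 2) * (x j k k).re := by
  rw [lineWalk_generator]
  have h0 := mul_nonneg (sq_nonneg (a k)) (hx (j - 1))
  have h1 := mul_nonneg (sq_nonneg (c k)) (hx (j + 1))
  linarith

theorem halfLineWalk_mass_conserved (a c : n → ℝ) (k : n) (x : BlockState ℕ n) :
    ∑' j, ((halfLineWalk (realDiagonal a) (realDiagonal c)).generator x j k k).re = 0 := by
  have h := (halfLineWalk_pairing_generator a c k (h := fun _ => 1) (M := 1)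
    (fun _ => by simp) x).2
  simpa using h

theorem lineWalk_mass_conserved (a c : n → ℝ) (k : n) (x : BlockState ℤ n) :
    ∑' j, ((lineWalk (realDiagonal a) (realDiagonal c)).generator x j k k).re = 0 := by
  have h := lineWalk_pairing_generator a c k (h := fun _ => 1) (M := 1) (fun _ => by simp) x
  have h1 : -(a k ^ 2 + c k ^ 2) * 1 + a k ^ 2 * 1 + c k ^ 2 * 1 = 0 := by ring
  simpa only [h1, one_mul, zero_mul, tsum_zero] using h

theorem abs_pow_le_one {r : ℝ} (h0 : 0 ≤ r) (h1 : r ≤ 1) (m : ℕ) : |r ^ m| ≤ 1 := by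
  rw [abs_of_nonneg (pow_nonneg h0 m)]
  exact pow_le_one₀ h0 h1

/-- For `r = c k ^ 2 / a k ^ 2 < 1`, `r ^ j` is the probability of reaching `0` from `j`, so it is
harmonic away from `0`. After summation by parts the series telescopes to its term at `0`. -/
theorem halfLineWalk_pairing_geometric (a c : n → ℝ) (k : n) {r : ℝ}
    (hr : r * a k ^ 2 = c k ^ 2) (hM : ∀ j : ℕ, |r ^ j| ≤ 1) (x : BlockState ℕ n) :
    ∑' j, r ^ j * ((halfLineWalk (realDiagonal a) (realDiagonal c)).generator x j k k).re =
      -((a k ^ 2 - c k ^ 2) * (x 0 k k).re) := by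
  obtain ⟨hs, h⟩ := halfLineWalk_pairing_generator a c k hM x
  rw [h]
  have h1 : ∀ j : ℕ, (r ^ (j + 1) - r ^ j) *
      (a k ^ 2 * (x j k k).re - c k ^ 2 * (x (j + 1) k k).re) =
      (c k ^ 2 - a k ^ 2) * (r ^ j * (x j k k).re) -
        (c k ^ 2 - a k ^ 2) * (r ^ (j + 1) * (x (j + 1) k k).re) := fun j => by
    rw [← hr]
    ring
  have h2 := (CTOQW.summable_mul_re_entry hM x k).mul_left (c k ^ 2 - a k ^ 2)
  rw [tsum_congr h1, h2.tsum_sub ((summable_nat_add_iff 1).2 h2), h2.tsum_eq_zero_add]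
  simp
  ring

/-- A `k`-th diagonal entry of the half-line walk started at `0` spends a finite total time at
`0` if and only if it vanishes or drifts to infinity. -/
theorem halfLineWalk_integrableOn_iff (a c : n → ℝ) (k : n) (ha : 0 < a k) (hc : 0 < c k)
    (ρ : Matrix n n ℂ) (hρ : 0 ≤ (ρ k k).re) :
    IntegrableOn (fun t : ℝ => ((halfLineWalk (realDiagonal a) (realDiagonal c)).semigroup t
      (CTOQW.initialState 0 ρ) 0 k k).re) (Set.Ioi 0) ↔ (ρ k k).re = 0 ∨ c k < a k := by
  set W := halfLineWalk (realDiagonal a) (realDiagonal c) with hW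
  set x : BlockState ℕ n := CTOQW.initialState 0 ρ with hx
  have hx0 : ∀ j, 0 ≤ (x j k k).re := CTOQW.re_initialState_nonneg 0 hρ
  have hpos : ∀ j t, 0 ≤ t → 0 ≤ (W.semigroup t x j k k).re := fun j t ht =>
    W.nonneg_semigroup_apply k _ (halfLineWalk_quasiPositive a c k) ht x hx0 j
  constructor
  · intro hi
    by_contra! h
    refine not_integrableOn_birthDeath_nat (u := fun j t => (W.semigroup t x j k k).re)
      (α := a k ^ 2) (β := c k ^ 2) (M := ∑' j, (x j k k).re) (by positivity)
      (pow_le_pow_left₀ ha.le h.2 2) (fun t => ?_) (fun j t => ?_) hpos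
      (fun j t ht => W.entry_semigroup_le k _ (halfLineWalk_quasiPositive a c k)
        (halfLineWalk_mass_conserved a c k) ht x hx0 j) ?_ (fun j => ?_) hi
    · rw [← halfLineWalk_generator_zero]
      exact W.hasDerivAt_entry_semigroup x 0 k t
    · rw [← halfLineWalk_generator_succ]
      exact W.hasDerivAt_entry_semigroup x (j + 1) k t
    · simp only [CTOQW.semigroup_zero, one_apply_eq_self]
      rw [hx, CTOQW.initialState_self]
      exact lt_of_le_of_ne hρ (Ne.symm h.1)
    · simp only [CTOQW.semigroup_zero, one_apply_eq_self]
      rw [hx, CTOQW.initialState_of_ne (Nat.succ_ne_zero j)]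
      simp
  · rintro (h | h)
    · refine integrableOn_zero.congr_fun (fun t ht => ?_) measurableSet_Ioi
      refine (W.entry_semigroup_eq_zero k _ (halfLineWalk_quasiPositive a c k)
        (le_of_lt ht) x (fun j => ?_) 0).symm
      by_cases hj : j = 0
      · rw [hj, hx, CTOQW.initialState_self, h]
      · rw [hx, CTOQW.initialState_of_ne hj]
        simp
    · have hr0 : 0 ≤ c k ^ 2 / a k ^ 2 := by positivity
      have hlt : c k ^ 2 < a k ^ 2 := pow_lt_pow_left₀ h hc.le two_ne_zero
      have hr1 : c k ^ 2 / a k ^ 2 ≤ 1 := (div_le_one (by positivity)).2 hlt.le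
      have hr : c k ^ 2 / a k ^ 2 * a k ^ 2 = c k ^ 2 := by field_simp
      have hM : ∀ j : ℕ, |(c k ^ 2 / a k ^ 2) ^ j| ≤ 1 := abs_pow_le_one hr0 hr1
      -- The potential is the mass that will still return to `0`; it decreases at rate `a k ^ 2 - c
      -- k ^ 2` times the mass at `0`.
      refine integrableOn_of_potential (sub_pos.2 hlt) (fun t => ?_) (hpos 0) (fun t ht => ?_)
        (φ := fun t => CTOQW.diagPairing k hM (W.semigroup t x))
      · refine (W.hasDerivAt_pairing_semigroup (CTOQW.diagPairing k hM) x t).congr_deriv ?_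
        rw [CTOQW.diagPairing_apply]
        exact halfLineWalk_pairing_geometric a c k hr hM _
      · rw [CTOQW.diagPairing_apply]
        exact tsum_nonneg fun j => mul_nonneg (pow_nonneg hr0 j) (hpos j t ht)

theorem lineWalk_pairing_potential (a c : n → ℝ) (k : n) (i : ℤ) {h : ℤ → ℝ} {κ : ℝ}
    (hM : ∀ j, |h j| ≤ 1)
    (hi : -(a k ^ 2 + c k ^ 2) * h i + a k ^ 2 * h (i + 1) + c k ^ 2 * h (i - 1) = -κ)
    (hj : ∀ j, j ≠ i →
      -(a k ^ 2 + c k ^ 2) * h j + a k ^ 2 * h (j + 1) + c k ^ 2 * h (j - 1) = 0)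
    (x : BlockState ℤ n) :
    ∑' j, h j * ((lineWalk (realDiagonal a) (realDiagonal c)).generator x j k k).re =
      -(κ * (x i k k).re) := by
  rw [lineWalk_pairing_generator a c k hM x, tsum_eq_single i fun j hji => by
    rw [hj j hji, zero_mul], hi, neg_mul]

/-- For an asymmetric birth-death chain on `ℤ`, the potential kernel of a vertex is bounded. -/
theorem exists_potential_int {α β : ℝ} (hα : 0 < α) (hβ : 0 < β) (h : α ≠ β) (i : ℤ) :
    ∃ (κ : ℝ) (g : ℤ → ℝ), 0 < κ ∧ (∀ j, 0 ≤ g j) ∧ (∀ j, |g j| ≤ 1) ∧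
      -(α + β) * g i + α * g (i + 1) + β * g (i - 1) = -κ ∧
      ∀ j, j ≠ i → -(α + β) * g j + α * g (j + 1) + β * g (j - 1) = 0 := by
  rcases h.lt_or_gt with h | h
  · have hr0 : 0 ≤ α / β := by positivity
    have hr1 : α / β ≤ 1 := (div_le_one hβ).2 h.le
    have hr : β * (α / β) = α := by field_simp
    -- Here the drift is to the left: `g j` is the probability of reaching `i` from `j`, and the
    -- truncation `toNat` gives the value `1` for `j ≥ i`. The other case is the mirror image.
    refine ⟨β - α, fun j => (α / β) ^ (i - j).toNat, sub_pos.2 h, fun j => pow_nonneg hr0 _,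
      fun j => abs_pow_le_one hr0 hr1 _, ?_, fun j hj => ?_⟩
    · have e1 : (i - i).toNat = 0 := by omega
      have e2 : (i - (i + 1)).toNat = 0 := by omega
      have e3 : (i - (i - 1)).toNat = 1 := by omega
      simp only [e1, e2, e3, pow_zero, pow_one, hr]
      ring
    · rcases lt_or_gt_of_ne hj with hj | hj
      · obtain ⟨m, hm⟩ : ∃ m : ℕ, (i - j).toNat = m + 1 := ⟨(i - j).toNat - 1, by omega⟩
        have e2 : (i - (j + 1)).toNat = m := by omega
        have e3 : (i - (j - 1)).toNat = m + 2 := by omega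
        simp only [hm, e2, e3, pow_succ]
        linear_combination (((α / β) ^ m) * (α / β) - (α / β) ^ m) * hr
      · have e1 : (i - j).toNat = 0 := by omega
        have e2 : (i - (j + 1)).toNat = 0 := by omega
        have e3 : (i - (j - 1)).toNat = 0 := by omega
        simp only [e1, e2, e3, pow_zero]
        ring
  · have hr0 : 0 ≤ β / α := by positivity
    have hr1 : β / α ≤ 1 := (div_le_one hα).2 h.le
    have hr : α * (β / α) = β := by field_simp
    refine ⟨α - β, fun j => (β / α) ^ (j - i).toNat, sub_pos.2 h, fun j => pow_nonneg hr0 _,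
      fun j => abs_pow_le_one hr0 hr1 _, ?_, fun j hj => ?_⟩
    · have e1 : (i - i).toNat = 0 := by omega
      have e2 : (i + 1 - i).toNat = 1 := by omega
      have e3 : (i - 1 - i).toNat = 0 := by omega
      simp only [e1, e2, e3, pow_zero, pow_one, hr]
      ring
    · rcases lt_or_gt_of_ne hj with hj | hj
      · have e1 : (j - i).toNat = 0 := by omega
        have e2 : (j + 1 - i).toNat = 0 := by omega
        have e3 : (j - 1 - i).toNat = 0 := by omega
        simp only [e1, e2, e3, pow_zero]
        ring
      · obtain ⟨m, hm⟩ : ∃ m : ℕ, (j - i).toNat = m + 1 := ⟨(j - i).toNat - 1, by omega⟩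
        have e2 : (j + 1 - i).toNat = m + 2 := by omega
        have e3 : (j - 1 - i).toNat = m := by omega
        simp only [hm, e2, e3, pow_succ]
        linear_combination (((β / α) ^ m) * (β / α) - (β / α) ^ m) * hr

/-- A `k`-th diagonal entry of the walk on the line started at `i` spends a finite total time at
`i` if and only if it vanishes or has a drift. -/
theorem lineWalk_integrableOn_iff (a c : n → ℝ) (k : n) (ha : 0 < a k) (hc : 0 < c k) (i : ℤ)
    (ρ : Matrix n n ℂ) (hρ : 0 ≤ (ρ k k).re) :
    IntegrableOn (fun t : ℝ => ((lineWalk (realDiagonal a) (realDiagonal c)).semigroup t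
      (CTOQW.initialState i ρ) i k k).re) (Set.Ioi 0) ↔ (ρ k k).re = 0 ∨ a k ≠ c k := by
  set W := lineWalk (realDiagonal a) (realDiagonal c) with hW
  set x : BlockState ℤ n := CTOQW.initialState i ρ with hx
  have hx0 : ∀ j, 0 ≤ (x j k k).re := CTOQW.re_initialState_nonneg i hρ
  have hpos : ∀ j t, 0 ≤ t → 0 ≤ (W.semigroup t x j k k).re := fun j t ht =>
    W.nonneg_semigroup_apply k _ (lineWalk_quasiPositive a c k) ht x hx0 j
  constructor
  · intro hi
    by_contra! h
    refine not_integrableOn_birthDeath_int (u := fun j t => (W.semigroup t x j k k).re)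
      (α := a k ^ 2) (M := ∑' j, (x j k k).re) (by positivity) (fun j t => ?_) hpos
      (fun j t ht => W.entry_semigroup_le k _ (lineWalk_quasiPositive a c k)
        (lineWalk_mass_conserved a c k) ht x hx0 j) ?_ (fun j hj => ?_) hi
    · refine (W.hasDerivAt_entry_semigroup x j k t).congr_deriv ?_
      rw [hW, lineWalk_generator, ← h.2]
    · simp only [CTOQW.semigroup_zero, one_apply_eq_self]
      rw [hx, CTOQW.initialState_self]
      exact lt_of_le_of_ne hρ (Ne.symm h.1)
    · simp only [CTOQW.semigroup_zero, one_apply_eq_self]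
      rw [hx, CTOQW.initialState_of_ne hj]
      simp
  · rintro (h | h)
    · refine integrableOn_zero.congr_fun (fun t ht => ?_) measurableSet_Ioi
      refine (W.entry_semigroup_eq_zero k _ (lineWalk_quasiPositive a c k)
        (le_of_lt ht) x (fun j => ?_) i).symm
      by_cases hj : j = i
      · rw [hj, hx, CTOQW.initialState_self, h]
      · rw [hx, CTOQW.initialState_of_ne hj]
        simp
    · have h2 : a k ^ 2 ≠ c k ^ 2 := fun h2 => h ((sq_eq_sq₀ ha.le hc.le).1 h2)
      obtain ⟨κ, g, hκ, hg0, hg1, hgi, hgj⟩ :=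
        exists_potential_int (pow_pos ha 2) (pow_pos hc 2) h2 i
      refine integrableOn_of_potential hκ (fun t => ?_) (hpos i) (fun t ht => ?_)
        (φ := fun t => CTOQW.diagPairing k hg1 (W.semigroup t x))
      · refine (W.hasDerivAt_pairing_semigroup (CTOQW.diagPairing k hg1) x t).congr_deriv ?_
        rw [CTOQW.diagPairing_apply]
        exact lineWalk_pairing_potential a c k i hg1 hgi hgj _
      · rw [CTOQW.diagPairing_apply]
        exact tsum_nonneg fun j => mul_nonneg (hg0 j) (hpos j t ht)

theorem IsDensity.re_diag_nonneg {m : Type} [Fintype m] {ρ : Matrix m m ℂ}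
    (hρ : IsDensity ρ) (k : m) :
    0 ≤ (ρ k k).re :=
  (Complex.le_def.1 (hρ.1.diag_nonneg (i := k))).1

theorem IsDensity.sum_re_diag {m : Type} [Fintype m] {ρ : Matrix m m ℂ}
    (hρ : IsDensity ρ) : ∑ k, (ρ k k).re = 1 := by
  have h := congrArg Complex.re hρ.2
  simpa [Matrix.trace] using h

theorem isDensity_single (k : n) : IsDensity (Matrix.single k k (1 : ℂ)) := by
  constructor
  · rw [← Matrix.diagonal_single]
    refine Matrix.PosSemidef.diagonal fun j => ?_
    by_cases h : j = k
    · subst h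
      simp
    · simp [h]
  · simp

/-- The return probability is a sum of nonnegative contributions, one per internal direction, so the
classical criterion applies to each separately; coherences of `ρ` play no role. -/
theorem halfLineWalk_rhoTransient_iff {a c : n → ℝ} (ha : ∀ k, 0 < a k) (hc : ∀ k, 0 < c k)
    {ρ : Matrix n n ℂ} (hρ : IsDensity ρ) :
    (halfLineWalk (realDiagonal a) (realDiagonal c)).RhoTransient 0 ρ ↔
      ∀ k, (ρ k k).re = 0 ∨ c k < a k := by
  rw [CTOQW.rhoTransient_iff_integrableOn _ _ _ fun k t ht =>
    CTOQW.nonneg_semigroup_apply _ k _ (halfLineWalk_quasiPositive a c k) ht _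
      (CTOQW.re_initialState_nonneg 0 (hρ.re_diag_nonneg k)) 0]
  exact forall_congr' fun k =>
    halfLineWalk_integrableOn_iff a c k (ha k) (hc k) ρ (hρ.re_diag_nonneg k)

theorem lineWalk_rhoTransient_iff {a c : n → ℝ} (ha : ∀ k, 0 < a k) (hc : ∀ k, 0 < c k) (i : ℤ)
    {ρ : Matrix n n ℂ} (hρ : IsDensity ρ) :
    (lineWalk (realDiagonal a) (realDiagonal c)).RhoTransient i ρ ↔
      ∀ k, (ρ k k).re = 0 ∨ a k ≠ c k := by
  rw [CTOQW.rhoTransient_iff_integrableOn _ _ _ fun k t ht =>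
    CTOQW.nonneg_semigroup_apply _ k _ (lineWalk_quasiPositive a c k) ht _
      (CTOQW.re_initialState_nonneg i (hρ.re_diag_nonneg k)) i]
  exact forall_congr' fun k =>
    lineWalk_integrableOn_iff a c k (ha k) (hc k) i ρ (hρ.re_diag_nonneg k)

end

/-! ### From the criterion for each density to the classification. -/

namespace CTOQW

variable {V n : Type} [Fintype n] [DecidableEq n] [DecidableEq V]

theorem rhoRecurrent_iff_not_rhoTransient (W : CTOQW V n) (i : V) (ρ : Matrix n n ℂ) :
    W.RhoRecurrent i ρ ↔ ¬ W.RhoTransient i ρ := by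
  rw [RhoRecurrent, RhoTransient, not_lt, top_le_iff]

/-- If transience is decided separately for every basis vector of the internal space, then a
vertex is transient if and only if it is so for all of them. -/
theorem transient_iff_forall {W : CTOQW V n} {i : V} {P : n → Prop}
    (hW : ∀ ρ, IsDensity ρ → (W.RhoTransient i ρ ↔ ∀ k, (ρ k k).re = 0 ∨ P k)) :
    W.Transient i ↔ ∀ k, P k := by
  refine ⟨fun h k => ?_, fun h ρ hρ => (hW ρ hρ).2 fun k => Or.inr (h k)⟩
  have h1 := (hW _ (isDensity_single k)).1 (h _ (isDensity_single k)) k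
  simpa using h1

/-- If transience is decided separately for every basis vector of the internal space, then a
vertex is recurrent if and only if it is transient for none of them. -/
theorem recurrent_iff_forall_not {W : CTOQW V n} {i : V} {P : n → Prop}
    (hW : ∀ ρ, IsDensity ρ → (W.RhoTransient i ρ ↔ ∀ k, (ρ k k).re = 0 ∨ P k)) :
    W.Recurrent i ↔ ∀ k, ¬ P k := by
  constructor
  · intro h k hk
    refine (W.rhoRecurrent_iff_not_rhoTransient i _).1 (h _ (isDensity_single k))
      ((hW _ (isDensity_single k)).2 fun l => ?_)
    by_cases hl : l = k
    · exact Or.inr (hl ▸ hk)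
    · left
      simp [Ne.symm hl]
  · intro h ρ hρ
    rw [rhoRecurrent_iff_not_rhoTransient, hW ρ hρ]
    intro h1
    have h2 := hρ.sum_re_diag
    rw [Finset.sum_eq_zero fun k _ => (h1 k).resolve_right (h k)] at h2
    exact zero_ne_one h2

end CTOQW

/-- A density matrix on `ℂ²` with a vanishing diagonal entry is the projection onto the other
basis vector. -/
theorem IsDensity.eq_single {ρ : Matrix (Fin 2) (Fin 2) ℂ} (hρ : IsDensity ρ) {k l : Fin 2}
    (hkl : k ≠ l) (h : (ρ k k).re = 0) : ρ = Matrix.single l l 1 := by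
  have him : ∀ m, (ρ m m).im = 0 := fun m =>
    (Complex.le_def.1 (hρ.1.diag_nonneg (i := m))).2.symm
  have hk : ρ k k = 0 := Complex.ext h (him k)
  have hdet := hρ.1.det_nonneg
  have hoff : ∀ p q, p ≠ q → ρ p q = 0 := by
    have h10 : ρ 1 0 = star (ρ 0 1) := (hρ.1.isHermitian.apply 1 0).symm
    have hprod : ρ 0 0 * ρ 1 1 = 0 := by
      fin_cases k
      · exact mul_eq_zero_of_left hk _
      · exact mul_eq_zero_of_right _ hk
    -- With a zero on the diagonal the determinant is `-|ρ 0 1|²`, and positivity forces `ρ 0 1 =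
    -- 0`.
    rw [Matrix.det_fin_two, hprod, h10, zero_sub, Complex.star_def, Complex.mul_conj] at hdet
    have h2 := (Complex.le_def.1 hdet).1
    simp only [Complex.zero_re, Complex.neg_re, Complex.ofReal_re] at h2
    have h3 : ρ 0 1 = 0 := Complex.normSq_eq_zero.1
      (le_antisymm (by linarith) (Complex.normSq_nonneg _))
    intro p q hpq
    fin_cases p <;> fin_cases q
    · exact absurd rfl hpq
    · exact h3
    · simpa [h3] using h10
    · exact absurd rfl hpq
  have hl : ρ l l = 1 := by
    have htr := hρ.2
    rw [Matrix.trace_fin_two] at htr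
    fin_cases k <;> fin_cases l
    · exact absurd rfl hkl
    · simpa [show ρ 0 0 = 0 from hk] using htr
    · simpa [show ρ 1 1 = 0 from hk] using htr
    · exact absurd rfl hkl
  ext p q
  by_cases hpq : p = q
  · subst hpq
    by_cases hp : p = l
    · subst hp
      simpa using hl
    · have : p = k := by omega
      subst this
      simpa [Matrix.single_apply, Ne.symm hp] using hk
  · rw [hoff p q hpq, Matrix.single_apply, if_neg (by rintro ⟨rfl, rfl⟩; exact hpq rfl)]

end OpenQuantumWalk

open OpenQuantumWalk in
theorem mainTheorem8 (a c : Fin 2 → ℝ) (ha : ∀ k, 0 < a k) (hc : ∀ k, 0 < c k) :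
    -- the half-line, vertex `0`
    (((halfLineWalk (realDiagonal a) (realDiagonal c)).Recurrent 0 ↔ ∀ k, a k ≤ c k) ∧
      ((halfLineWalk (realDiagonal a) (realDiagonal c)).Transient 0 ↔ ∀ k, c k < a k) ∧
      (a 0 ≤ c 0 → c 1 < a 1 →
        (halfLineWalk (realDiagonal a) (realDiagonal c)).RhoTransient 0 (Matrix.single 1 1 1) ∧
        ∀ ρ : Matrix (Fin 2) (Fin 2) ℂ, IsDensity ρ → ρ ≠ Matrix.single 1 1 1 →
          (halfLineWalk (realDiagonal a) (realDiagonal c)).RhoRecurrent 0 ρ) ∧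
      (c 0 < a 0 → a 1 ≤ c 1 →
        (halfLineWalk (realDiagonal a) (realDiagonal c)).RhoTransient 0 (Matrix.single 0 0 1) ∧
        ∀ ρ : Matrix (Fin 2) (Fin 2) ℂ, IsDensity ρ → ρ ≠ Matrix.single 0 0 1 →
          (halfLineWalk (realDiagonal a) (realDiagonal c)).RhoRecurrent 0 ρ)) ∧
    -- the line, every vertex `i`
    ∀ i : ℤ,
      ((lineWalk (realDiagonal a) (realDiagonal c)).Recurrent i ↔ ∀ k, a k = c k) ∧
      ((lineWalk (realDiagonal a) (realDiagonal c)).Transient i ↔ ∀ k, a k ≠ c k) ∧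
      (a 0 = c 0 → a 1 ≠ c 1 → ∀ ρ : Matrix (Fin 2) (Fin 2) ℂ, IsDensity ρ →
        ((ρ 0 0).re = 0 → (lineWalk (realDiagonal a) (realDiagonal c)).RhoTransient i ρ) ∧
        (0 < (ρ 0 0).re → (lineWalk (realDiagonal a) (realDiagonal c)).RhoRecurrent i ρ)) ∧
      (a 0 ≠ c 0 → a 1 = c 1 → ∀ ρ : Matrix (Fin 2) (Fin 2) ℂ, IsDensity ρ →
        ((ρ 0 0).re = 1 → (lineWalk (realDiagonal a) (realDiagonal c)).RhoTransient i ρ) ∧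
        ((ρ 0 0).re < 1 → (lineWalk (realDiagonal a) (realDiagonal c)).RhoRecurrent i ρ)) := by

  have hN : ∀ ρ, IsDensity ρ → _ := fun ρ hρ => halfLineWalk_rhoTransient_iff ha hc (ρ := ρ) hρ
  refine ⟨⟨?_, CTOQW.transient_iff_forall hN, fun h0 h1 => ⟨?_, fun ρ hρ hne => ?_⟩,
    fun h0 h1 => ⟨?_, fun ρ hρ hne => ?_⟩⟩, fun i => ?_⟩
  · simpa only [not_lt] using CTOQW.recurrent_iff_forall_not hN
  · rw [hN _ (isDensity_single 1), Fin.forall_fin_two]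
    exact ⟨Or.inl (by simp), Or.inr h1⟩
  · rw [CTOQW.rhoRecurrent_iff_not_rhoTransient, hN ρ hρ]
    -- Direction `0` is recurrent, so transience would force `ρ 0 0 = 0`, which leaves only the
    -- excluded pure state.
    exact fun h => hne (hρ.eq_single zero_ne_one ((h 0).resolve_right h0.not_gt))
  · rw [hN _ (isDensity_single 0), Fin.forall_fin_two]
    exact ⟨Or.inr h0, Or.inl (by simp)⟩
  · rw [CTOQW.rhoRecurrent_iff_not_rhoTransient, hN ρ hρ]
    exact fun h => hne (hρ.eq_single one_ne_zero ((h 1).resolve_right h1.not_gt))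
  · have hZ : ∀ ρ, IsDensity ρ → _ := fun ρ hρ => lineWalk_rhoTransient_iff ha hc i (ρ := ρ) hρ
    refine ⟨?_, CTOQW.transient_iff_forall hZ, fun h0 h1 ρ hρ => ?_, fun h0 h1 ρ hρ => ?_⟩
    · simpa only [ne_eq, not_not] using CTOQW.recurrent_iff_forall_not hZ
    · rw [CTOQW.rhoRecurrent_iff_not_rhoTransient, hZ ρ hρ, Fin.forall_fin_two]
      exact ⟨fun h => ⟨Or.inl h, Or.inr h1⟩,
        fun h h' => h.ne' (h'.1.resolve_right fun h2 => h2 h0)⟩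
    · have hsum := hρ.sum_re_diag
      rw [Fin.sum_univ_two] at hsum
      rw [CTOQW.rhoRecurrent_iff_not_rhoTransient, hZ ρ hρ, Fin.forall_fin_two]
      -- The recurrent direction is now `1`; the unit trace turns conditions on `ρ 0 0` into
      -- conditions on `ρ 1 1`.
      refine ⟨fun h => ⟨Or.inr h0, Or.inl (by linarith)⟩, fun h h' => ?_⟩
      have h3 := h'.2.resolve_right fun h2 => h2 h1
      linarith
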